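/- Let $K$ be a commutative ring. Let $\widehat\Lambda$ be the $K$-algebra of all symmetric formal power series over $K$ in the variables $x=(x_1,x_2,\dots)$ (of possibly unbounded degree), and let $\Lambda\subset\widehat\Lambda$ be the ring of symmetric functions, i.e. the symmetric power series of bounded degree. Let $(\,,)\colon\widehat\Lambda\times\Lambda\to K$ be the Hall inner product, $\bigl(\sum_\lambda A_\lambda s_\lambda,\sum_\lambda B_\lambda s_\lambda\bigr)=\sum_\lambda A_\lambda B_\lambda$, where $s_\lambda$ are the Schur functions. Let $\Delta\colon\Lambda\to\Lambda\otimes_K\Lambda$ be the coproduct $f(x)\mapsto f(x,y)\in\Lambda(x)\otimes\Lambda(y)$, where $f(x,y)=f(x_1,x_2,\dots,y_1,y_2,\dots)$. For $F\in\widehat\Lambda$ let $(F,-)\colon\Lambda\to K$ be the linear map $f\mapsto(F,f)$, and let $F^\perp=((F,-)\otimes\mathrm{id})\circ\Delta\colon\Lambda\to\Lambda$, i.e. $F^\perp(f)=\sum(F,f_1)f_2$ where $\Delta(f)=\sum f_1\otimes f_2$. Then for every $F\in\widehat\Lambda$ the following are equivalent: 1. $F$ is group-like, that is, $F(x,y)=F(x)F(y)$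 and the constant term $F(0)$ is $1$. 2. $(F,-)\colon\Lambda\to K$ is a homomorphism of (unital) $K$-algebras. 3. $F^\perp\colon\Lambda\to\Lambda$ is an automorphism of the $K$-algebra $\Lambda$. -/

import Mathlib

open scoped TensorProduct

noncomputable section

namespace SymmFn

/-! ### Symmetric power series and symmetric functions -/

/-- The completed ring of symmetric functions: all formal power series in countably many variables
`x_0, x_1, …` over `K` (of possibly unbounded degree) which are invariant under every permutation
of the variables. -/
def SymSeries (K : Type*) [CommRing K] : Subalgebra K (MvPowerSeries ℕ K) where
  carrier := {F | ∀ σ : Equiv.Perm ℕ, MvPowerSeries.rename σ F = F}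
  mul_mem' ha hb σ := by rw [map_mul, ha σ, hb σ]
  add_mem' ha hb σ := by rw [map_add, ha σ, hb σ]
  algebraMap_mem' r σ := AlgHom.commutes _ r

/-- The ring of symmetric functions: the symmetric power series of bounded degree. -/
def SymFun (K : Type*) [CommRing K] : Subalgebra K (MvPowerSeries ℕ K) where
  carrier := {f | f ∈ SymSeries K ∧ ∃ N : ℕ, ∀ d : ℕ →₀ ℕ, N < d.degree → f.coeff d = 0}
  mul_mem' := by
    rintro a b ⟨ha, N, hN⟩ ⟨hb, M, hM⟩
    refine ⟨mul_mem ha hb, N + M, fun d hd => ?_⟩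
    classical
    rw [MvPowerSeries.coeff_mul]
    refine Finset.sum_eq_zero fun p hp => ?_
    rw [Finset.HasAntidiagonal.mem_antidiagonal] at hp
    have h : N < p.1.degree ∨ M < p.2.degree := by
      rw [← hp, map_add] at hd
      omega
    rcases h with h | h
    · rw [hN _ h, zero_mul]
    · rw [hM _ h, mul_zero]
  add_mem' := by
    rintro a b ⟨ha, N, hN⟩ ⟨hb, M, hM⟩
    refine ⟨add_mem ha hb, max N M, fun d hd => ?_⟩
    rw [map_add, hN _ ((le_max_left _ _).trans_lt hd), hM _ ((le_max_right _ _).trans_lt hd),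
      add_zero]
  algebraMap_mem' r := by
    refine ⟨Subalgebra.algebraMap_mem _ r, 0, fun d hd => ?_⟩
    classical
    rw [MvPowerSeries.algebraMap_apply, MvPowerSeries.coeff_C, if_neg]
    rintro rfl
    simp at hd

/-! ### Schur functions and the Hall inner product -/

/-- The content of a semistandard tableau `T`: the exponent vector of
the monomial `x^T`, the product of the `x_{T(c)}` over all cells `c`. -/
def content {lam : YoungDiagram} (T : SemistandardYoungTableau lam) : ℕ →₀ ℕ :=
  ∑ c ∈ lam.cells, Finsupp.single (T c.1 c.2) 1

/-- The Schur function `s_lam`, the sum of `x^T` over all semistandard tableaux of shape `lam`. -/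
def schur (K : Type*) [CommRing K] (lam : YoungDiagram) : MvPowerSeries ℕ K :=
  fun d => (Nat.card {T : SemistandardYoungTableau lam // content T = d} : K)

/-- The partitions of `n`, as Young diagrams with `n` cells. -/
abbrev Part (n : ℕ) : Type := {lam : YoungDiagram // lam.card = n}

theorem subset_range_of_card {n : ℕ} (lam : Part n) :
    lam.1.cells ⊆ Finset.range n ×ˢ Finset.range n := by
  obtain ⟨lam, rfl⟩ := lam
  rintro ⟨i, j⟩ h
  have hi : (Finset.range (i + 1) ×ˢ Finset.range (j + 1)) ⊆ lam.cells := by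
    rintro ⟨a, b⟩ hab
    simp only [Finset.mem_product, Finset.mem_range] at hab
    exact lam.up_left_mem (by omega) (by omega) h
  have hc := Finset.card_le_card hi
  rw [Finset.card_product, Finset.card_range, Finset.card_range] at hc
  simp only [Finset.mem_product, Finset.mem_range, YoungDiagram.card]
  constructor <;> nlinarith

instance (n : ℕ) : Finite (Part n) :=
  Finite.of_injective
    (fun lam : Part n => (⟨lam.1.cells, Finset.mem_powerset.2 (subset_range_of_card lam)⟩ :
      {s // s ∈ (Finset.range n ×ˢ Finset.range n).powerset}))
    fun _ _ h => Subtype.ext (YoungDiagram.ext (congrArg Subtype.val h))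

instance (n : ℕ) : Fintype (Part n) := Fintype.ofFinite _

instance (n : ℕ) : DecidableEq (Part n) := Classical.decEq _

/-- The exponent vector of the monomial `x^lam = x_0^{lam_0} x_1^{lam_1} ⋯`. -/
def expo (lam : YoungDiagram) : ℕ →₀ ℕ :=
  Finsupp.onFinset (Finset.range (lam.colLen 0)) lam.rowLen fun i hi => by
    rw [Finset.mem_range, ← YoungDiagram.mem_iff_lt_colLen, YoungDiagram.mem_iff_lt_rowLen]
    omega

/-- The matrix of the coefficients of `x^mu` in `s_lam`, for partitions `lam`, `mu` of `n`. -/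
def kostka (K : Type*) [CommRing K] (n : ℕ) : Matrix (Part n) (Part n) K :=
  Matrix.of fun lam mu => (schur K lam.1).coeff (expo mu.1)

/-- The coefficients `A_lam`, `lam` a partition of `n`, in the Schur expansion
`F = ∑ A_lam s_lam` of a symmetric power series `F`. As `F` is determined by its
coefficients at the monomials `x^mu`, they are the solution of the linear system
`[x^mu] F = ∑_lam A_lam [x^mu] s_lam`, whose matrix is invertible
(see `kostka_det` below; `schurCoeff_spec` and `schurCoeff_unique` for the solution). -/
def schurCoeff (K : Type*) [CommRing K] (n : ℕ) : MvPowerSeries ℕ K →ₗ[K] (Part n → K) where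
  toFun F := Matrix.vecMul (fun mu : Part n => F.coeff (expo mu.1)) (kostka K n)⁻¹
  map_add' F G := by
    rw [← Matrix.add_vecMul]
    congr 1
  map_smul' r F := by
    rw [RingHom.id_apply, ← Matrix.smul_vecMul]
    congr 1

theorem degree_expo (lam : YoungDiagram) : (expo lam).degree = lam.card := by
  have hs : (expo lam).support ⊆ Finset.range (lam.colLen 0) := Finsupp.support_onFinset_subset
  rw [Finsupp.degree_apply, Finset.sum_subset hs (fun i _ hi => by simpa using hi),
    YoungDiagram.card]
  rw [Finset.card_eq_sum_card_fiberwise (f := Prod.fst) (t := Finset.range (lam.colLen 0))]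
  · exact Finset.sum_congr rfl fun i _ => lam.rowLen_eq_card
  · rintro ⟨i, j⟩ h
    rw [Finset.coe_range, Set.mem_Iio, ← YoungDiagram.mem_iff_lt_colLen]
    exact lam.up_left_mem le_rfl (Nat.zero_le _) h

theorem finite_support_schurCoeff {K : Type*} [CommRing K] (F : MvPowerSeries ℕ K) (f : SymFun K) :
    (Function.support fun n => ∑ lam : Part n, schurCoeff K n F lam * schurCoeff K n f lam).Finite := by
  obtain ⟨N, hN⟩ := f.2.2
  refine (Set.finite_Iic N).subset fun n hn => ?_
  by_contra h
  refine hn (Finset.sum_eq_zero fun lam _ => ?_)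
  have h0 : (fun mu : Part n => MvPowerSeries.coeff (expo mu.1) (f : MvPowerSeries ℕ K)) = 0 := by
    funext mu
    refine hN _ ?_
    rw [degree_expo, mu.2]
    simpa using h
  have h1 : schurCoeff K n (f : MvPowerSeries ℕ K) = 0 := by
    change Matrix.vecMul _ _ = 0
    rw [h0, Matrix.zero_vecMul]
  rw [h1]
  simp

/-- The Hall inner product, extended to a pairing of symmetric power series with symmetric
functions: `(∑ A_lam s_lam, ∑ B_lam s_lam) = ∑ A_lam B_lam`, so that `(s_lam, s_mu) = δ`.
Only finitely many terms are nonzero since the second argument has bounded degree. -/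
def hall {K : Type*} [CommRing K] : SymSeries K →ₗ[K] SymFun K →ₗ[K] K :=
  LinearMap.mk₂ K
    (fun F f => ∑ᶠ n : ℕ, ∑ lam : Part n, schurCoeff K n F lam * schurCoeff K n f lam)
    (fun F G f => by
      rw [← finsum_add_distrib (finite_support_schurCoeff _ _) (finite_support_schurCoeff _ _)]
      simp [add_mul, Finset.sum_add_distrib])
    (fun r F f => by
      rw [smul_finsum' _ (finite_support_schurCoeff _ _)]
      simp [Finset.mul_sum, mul_assoc])
    (fun F f g => by
      rw [← finsum_add_distrib (finite_support_schurCoeff _ _) (finite_support_schurCoeff _ _)]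
      simp [mul_add, Finset.sum_add_distrib])
    (fun r F f => by
      rw [smul_finsum' _ (finite_support_schurCoeff _ _)]
      simp [Finset.mul_sum, mul_left_comm])

theorem le_entry {lam : YoungDiagram} (T : SemistandardYoungTableau lam) {i j : ℕ}
    (h : (i, j) ∈ lam) : i ≤ T i j := by
  induction i with
  | zero => exact Nat.zero_le _
  | succ i ih =>
    have h' : (i, j) ∈ lam := lam.up_left_mem (Nat.le_succ i) le_rfl h
    have : T i j < T (i + 1) j := T.col_strict (Nat.lt_succ_self i) h
    have := ih h'
    omega

/-- Weighted counting of entries. -/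
theorem content_sum {lam : YoungDiagram} (T : SemistandardYoungTableau lam) (w : ℕ → ℕ) :
    ((content T).sum fun i k => k * w i) = ∑ c ∈ lam.cells, w (T c.1 c.2) := by
  rw [content, ← Finsupp.sum_finsetSum_index (by simp) (by intros; ring)]
  exact Finset.sum_congr rfl fun c _ => by simp

theorem content_highestWeight (lam : YoungDiagram) :
    content (SemistandardYoungTableau.highestWeight lam) = expo lam := by
  ext i
  rw [content, Finsupp.finsetSum_apply]
  change _ = lam.rowLen i
  rw [YoungDiagram.rowLen_eq_card, YoungDiagram.row, Finset.card_filter]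
  refine Finset.sum_congr rfl fun c hc => ?_
  have hc' : (c.1, c.2) ∈ lam := hc
  rw [SemistandardYoungTableau.highestWeight_apply, if_pos hc', Finsupp.single_apply]

theorem eq_highestWeight {lam : YoungDiagram} (T : SemistandardYoungTableau lam)
    (hT : content T = expo lam) : T = SemistandardYoungTableau.highestWeight lam := by
  have h1 := content_sum T id
  have h2 := content_sum (SemistandardYoungTableau.highestWeight lam) id
  rw [content_highestWeight, ← hT, h1] at h2
  have h3 : ∀ c ∈ lam.cells, SemistandardYoungTableau.highestWeight lam c.1 c.2 = c.1 := by
    intro c hc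
    have hc' : (c.1, c.2) ∈ lam := hc
    rw [SemistandardYoungTableau.highestWeight_apply, if_pos hc']
  have h4 : ∀ c ∈ lam.cells, c.1 = T c.1 c.2 := by
    refine (Finset.sum_eq_sum_iff_of_le fun c hc => le_entry T hc).1 ?_
    rw [← Finset.sum_congr rfl h3]
    exact h2.symm
  ext i j
  rw [SemistandardYoungTableau.highestWeight_apply]
  split_ifs with h
  · exact (h4 (i, j) h).symm
  · exact T.zeros h

theorem kostka_diag (K : Type*) [CommRing K] {n : ℕ} (lam : Part n) : kostka K n lam lam = 1 := by
  have : Nat.card {T : SemistandardYoungTableau lam.1 // content T = expo lam.1} = 1 := by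
    rw [Nat.card_eq_one_iff_unique]
    exact ⟨⟨fun a b => Subtype.ext ((eq_highestWeight _ a.2).trans (eq_highestWeight _ b.2).symm)⟩,
      ⟨⟨_, content_highestWeight _⟩⟩⟩
  change ((Nat.card _ : ℕ) : K) = 1
  rw [this, Nat.cast_one]

theorem expo_injective : Function.Injective expo := by
  intro a b h
  ext ⟨i, j⟩
  have : a.rowLen i = b.rowLen i := DFunLike.congr_fun h i
  rw [YoungDiagram.mem_cells, YoungDiagram.mem_cells, YoungDiagram.mem_iff_lt_rowLen,
    YoungDiagram.mem_iff_lt_rowLen, this]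

theorem kostka_eq_zero (K : Type*) [CommRing K] {n : ℕ} {lam mu : Part n}
    (h : toLex (expo lam.1) < toLex (expo mu.1)) : kostka K n lam mu = 0 := by
  obtain ⟨i, h1, h2⟩ := Finsupp.Lex.lt_iff.1 h
  have : IsEmpty {T : SemistandardYoungTableau lam.1 // content T = expo mu.1} := by
    refine ⟨fun ⟨T, hT⟩ => ?_⟩
    have e1 := content_sum T fun k => if k ≤ i then 1 else 0
    have e2 := content_sum (SemistandardYoungTableau.highestWeight lam.1)
      fun k => if k ≤ i then 1 else 0
    rw [hT] at e1
    rw [content_highestWeight] at e2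
    have e3 : ∀ g : ℕ →₀ ℕ, (g.sum fun k m => m * if k ≤ i then 1 else 0) =
        ∑ k ∈ Finset.range (i + 1), g k := by
      intro g
      rw [Finsupp.sum_of_support_subset (s := g.support ∪ Finset.range (i + 1)) _
        Finset.subset_union_left _ (by simp)]
      simp only [mul_ite, mul_one, mul_zero]
      rw [← Finset.sum_filter]
      refine Finset.sum_subset_zero_on_sdiff (s₁ := _) (fun k hk => ?_) (fun k hk => ?_)
        (fun _ _ => rfl)
      · simp only [Finset.mem_filter] at hk
        simpa [Nat.lt_succ_iff] using hk.2
      · simp only [Finset.mem_sdiff, Finset.mem_filter, Finset.mem_union, Finset.mem_range] at hk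
        exact absurd ⟨Or.inr hk.1, by omega⟩ hk.2
    rw [e3] at e1 e2
    have e4 : (∑ k ∈ Finset.range (i + 1), expo mu.1 k)
        ≤ ∑ k ∈ Finset.range (i + 1), expo lam.1 k := by
      rw [e1, e2]
      refine Finset.sum_le_sum fun c hc => ?_
      have hc' : (c.1, c.2) ∈ lam.1 := hc
      rw [SemistandardYoungTableau.highestWeight_apply, if_pos hc']
      have := le_entry T hc'
      split_ifs <;> omega
    rw [Finset.sum_range_succ, Finset.sum_range_succ] at e4
    have e5 : ∑ k ∈ Finset.range i, expo lam.1 k = ∑ k ∈ Finset.range i, expo mu.1 k :=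
      Finset.sum_congr rfl fun k hk => h1 k (Finset.mem_range.1 hk)
    have e6 : expo lam.1 i < expo mu.1 i := h2
    omega
  change ((Nat.card _ : ℕ) : K) = 0
  rw [Nat.card_of_isEmpty, Nat.cast_zero]

theorem det_eq_one_of_triangular {m α R : Type*} [Fintype m] [DecidableEq m] [LinearOrder α]
    [CommRing R] (b : m → α) (hb : Function.Injective b) (M : Matrix m m R)
    (h : ∀ i j, b i < b j → M i j = 0) (h1 : ∀ i, M i i = 1) : M.det = 1 := by
  let : LinearOrder m := LinearOrder.lift' b hb
  have := Matrix.det_of_isLowerTriangular M fun i j hij => h i j hij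
  simp only [h1, Finset.prod_const_one] at this
  convert this

theorem kostka_det (K : Type*) [CommRing K] (n : ℕ) : (kostka K n).det = 1 :=
  det_eq_one_of_triangular (fun lam : Part n => toLex (expo lam.1))
    (fun _ _ h => Subtype.ext (expo_injective (toLex.injective h))) _
    (fun _ _ h => kostka_eq_zero K h) (kostka_diag K)

theorem schurCoeff_spec (K : Type*) [CommRing K] {n : ℕ} (F : MvPowerSeries ℕ K) (mu : Part n) :
    F.coeff (expo mu.1) = ∑ lam : Part n, schurCoeff K n F lam * (schur K lam.1).coeff (expo mu.1) := by
  have h : Matrix.vecMul (schurCoeff K n F) (kostka K n) = fun mu : Part n => F.coeff (expo mu.1) := by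
    change Matrix.vecMul (Matrix.vecMul _ _) _ = _
    rw [Matrix.vecMul_vecMul, Matrix.nonsing_inv_mul _ (by rw [kostka_det]; exact isUnit_one),
      Matrix.vecMul_one]
  exact (congrFun h mu).symm

theorem schurCoeff_unique (K : Type*) [CommRing K] {n : ℕ} (F : MvPowerSeries ℕ K) (A : Part n → K)
    (h : ∀ mu : Part n, F.coeff (expo mu.1) = ∑ lam : Part n, A lam * (schur K lam.1).coeff (expo mu.1)) :
    schurCoeff K n F = A := by
  have h' : (fun mu : Part n => F.coeff (expo mu.1)) = Matrix.vecMul A (kostka K n) := funext h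
  change Matrix.vecMul (fun mu : Part n => F.coeff (expo mu.1)) _ = _
  rw [h', Matrix.vecMul_vecMul, Matrix.mul_nonsing_inv _ (by rw [kostka_det]; exact isUnit_one),
    Matrix.vecMul_one]

theorem coeff_schur_of_card_ne (K : Type*) [CommRing K] (l m : YoungDiagram) (h : l.card ≠ m.card) : (schur K l).coeff (expo m) = 0 := by
  have : IsEmpty {T : SemistandardYoungTableau l // content T = expo m} := by
    refine ⟨fun ⟨T,hT⟩ => h ?_⟩
    rw [← degree_expo m, ← hT, content, map_sum]
    simp [YoungDiagram.card]
  change ((Nat.card _ : ℕ) : K) = 0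
  rw [Nat.card_of_isEmpty, Nat.cast_zero]

open Classical in
theorem schurCoeff_schur (K : Type*) [CommRing K] (l : YoungDiagram) (n) (p : Part n) : schurCoeff K n (schur K l) p = if l = p.1 then 1 else 0 := by
  rw [schurCoeff_unique K (n := n) (schur K l) (fun p => if l = p.1 then 1 else 0)]
  intro mu
  by_cases h : l.card = n
  · rw [Finset.sum_eq_single ⟨l, h⟩]
    · simp
    · intro b _ hb
      rw [if_neg, zero_mul]
      rintro rfl; exact hb rfl
    · simp
  · rw [coeff_schur_of_card_ne K l mu.1 (by rw [mu.2]; exact h), Finset.sum_eq_zero]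
    intro b _
    rw [if_neg, zero_mul]
    rintro rfl; exact h b.2

open Classical in
/-- The Schur functions are orthonormal for `hall`. -/
theorem hall_schur {K : Type*} [CommRing K] (l m : YoungDiagram) (F : SymSeries K) (f : SymFun K) (hF : F.1 = schur K l) (hf : f.1 = schur K m) :
   hall F f = if l = m then 1 else 0 := by
  change ∑ᶠ n : ℕ, ∑ lam : Part n, schurCoeff K n F.1 lam * schurCoeff K n f.1 lam = _
  rw [hF, hf, finsum_eq_single _ l.card]
  · rw [Finset.sum_eq_single ⟨l, rfl⟩]
    · simp [schurCoeff_schur, eq_comm]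
    · intro b _ hb
      rw [schurCoeff_schur, if_neg, zero_mul]
      rintro h; exact hb (Subtype.ext h.symm)
    · simp
  · intro n hn
    refine Finset.sum_eq_zero fun b _ => ?_
    rw [schurCoeff_schur, if_neg, zero_mul]
    rintro rfl; exact hn b.2.symm

/-! ### Two sets of variables, the coproduct, and the adjoint maps -/

section TwoSets

variable {K : Type*} [CommRing K]

instance : Filter.TendstoCofinite (Sum.inl : ℕ → ℕ ⊕ ℕ) :=
  Filter.tendstoCofinite_of_injective Sum.inl_injective

instance : Filter.TendstoCofinite (Sum.inr : ℕ → ℕ ⊕ ℕ) :=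
  Filter.tendstoCofinite_of_injective Sum.inr_injective

/-- `F(x) = F(x_0, x_1, …)`, as a power series in `x_0, x_1, …, y_0, y_1, …`
(`x_i` and `y_i` are the variables of index `Sum.inl i` and `Sum.inr i`). -/
def inX : MvPowerSeries ℕ K →ₐ[K] MvPowerSeries (ℕ ⊕ ℕ) K := MvPowerSeries.rename Sum.inl

/-- `F(y) = F(y_0, y_1, …)`. -/
def inY : MvPowerSeries ℕ K →ₐ[K] MvPowerSeries (ℕ ⊕ ℕ) K := MvPowerSeries.rename Sum.inr

/-- `F(x, y)`: the variables of `F` are replaced by `x_0, y_0, x_1, y_1, …`. For symmetric `F` the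
order in which the `x_i` and the `y_i` are listed does not matter. -/
def inXY : MvPowerSeries ℕ K →ₐ[K] MvPowerSeries (ℕ ⊕ ℕ) K :=
  MvPowerSeries.rename Equiv.natSumNatEquivNat.symm

theorem coeff_rename_equiv {α β : Type*} (e : α ≃ β) (F : MvPowerSeries α K) (d : α →₀ ℕ) :
    (MvPowerSeries.rename e F).coeff (d.mapDomain e) = F.coeff d := by
  have := MvPowerSeries.coeff_embDomain_rename e.toEmbedding F d
  rw [Finsupp.embDomain_eq_mapDomain] at this
  exact this

theorem coeff_perm {F : MvPowerSeries ℕ K} (hF : F ∈ SymSeries K) (σ : Equiv.Perm ℕ) (d : ℕ →₀ ℕ) :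
    F.coeff (d.mapDomain σ) = F.coeff d := by
  conv_lhs => rw [← hF σ]
  exact coeff_rename_equiv σ F d

theorem inXY_eq {F : MvPowerSeries ℕ K} (hF : F ∈ SymSeries K) (e : ℕ ≃ ℕ ⊕ ℕ) :
    MvPowerSeries.rename e F = inXY F := by
  conv_lhs => rw [← hF (Equiv.natSumNatEquivNat.symm.trans e.symm)]
  rw [MvPowerSeries.rename_rename, inXY]
  congr 2
  funext n
  simp

theorem coeff_inXY_perm {F : MvPowerSeries ℕ K} (hF : F ∈ SymSeries K) (σ τ : Equiv.Perm ℕ)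
    (d e : ℕ →₀ ℕ) :
    (inXY F).coeff ((d.mapDomain σ).sumElim (e.mapDomain τ)) = (inXY F).coeff (d.sumElim e) := by
  have h1 : (d.mapDomain σ).sumElim (e.mapDomain τ)
      = (d.sumElim e).mapDomain (Equiv.sumCongr σ τ) := by
    rw [Finsupp.sumElim_eq_add, Finsupp.sumElim_eq_add, Finsupp.mapDomain_add,
      ← Finsupp.mapDomain_comp, ← Finsupp.mapDomain_comp, ← Finsupp.mapDomain_comp,
      ← Finsupp.mapDomain_comp]
    rfl
  have h2 : MvPowerSeries.rename (Equiv.sumCongr σ τ) (inXY F) = inXY F := by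
    conv_rhs => rw [← inXY_eq hF (Equiv.natSumNatEquivNat.symm.trans (Equiv.sumCongr σ τ))]
    rw [inXY, MvPowerSeries.rename_rename]
    rfl
  rw [h1]
  conv_lhs => rw [← h2]
  exact coeff_rename_equiv _ _ _

theorem coeff_inX_mul_inY (F G : MvPowerSeries ℕ K) (d e : ℕ →₀ ℕ) :
    (inX F * inY G).coeff (d.sumElim e) = F.coeff d * G.coeff e := by
  classical
  have hX : (inX F).coeff (d.mapDomain Sum.inl) = F.coeff d := by
    have := MvPowerSeries.coeff_embDomain_rename (Function.Embedding.inl : ℕ ↪ ℕ ⊕ ℕ) F d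
    rw [Finsupp.embDomain_eq_mapDomain] at this
    exact this
  have hY : (inY G).coeff (e.mapDomain Sum.inr) = G.coeff e := by
    have := MvPowerSeries.coeff_embDomain_rename (Function.Embedding.inr : ℕ ↪ ℕ ⊕ ℕ) G e
    rw [Finsupp.embDomain_eq_mapDomain] at this
    exact this
  rw [MvPowerSeries.coeff_mul,
    Finset.sum_eq_single (d.mapDomain Sum.inl, e.mapDomain Sum.inr), hX, hY]
  · rintro ⟨a, b⟩ hp hne
    rw [Finset.HasAntidiagonal.mem_antidiagonal] at hp
    by_cases ha : a ∈ Set.range (Finsupp.mapDomain (Sum.inl : ℕ → ℕ ⊕ ℕ) (M := ℕ))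
    · by_cases hb : b ∈ Set.range (Finsupp.mapDomain (Sum.inr : ℕ → ℕ ⊕ ℕ) (M := ℕ))
      · obtain ⟨a, rfl⟩ := ha
        obtain ⟨b, rfl⟩ := hb
        rw [← Finsupp.sumElim_eq_add] at hp
        have h1 : a = d := by
          ext i
          exact DFunLike.congr_fun hp (Sum.inl i)
        have h2 : b = e := by
          ext i
          exact DFunLike.congr_fun hp (Sum.inr i)
        subst h1 h2
        exact absurd rfl hne
      · rw [inY, MvPowerSeries.coeff_rename_eq_zero _ _ hb, mul_zero]
    · rw [inX, MvPowerSeries.coeff_rename_eq_zero _ _ ha, zero_mul]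
  · intro h
    rw [Finset.HasAntidiagonal.mem_antidiagonal, ← Finsupp.sumElim_eq_add] at h
    exact absurd rfl h

/-- Exponent vectors up to a permutation of the variables. -/
def orbitSetoid : Setoid (ℕ →₀ ℕ) where
  r d e := ∃ σ : Equiv.Perm ℕ, d.mapDomain σ = e
  iseqv :=
    { refl := fun d => ⟨1, Finsupp.mapDomain_id⟩
      symm := by
        rintro d _ ⟨σ, rfl⟩
        refine ⟨σ.symm, ?_⟩
        rw [← Finsupp.mapDomain_comp]
        convert! Finsupp.mapDomain_id
        simp
      trans := by
        rintro d _ _ ⟨σ, rfl⟩ ⟨τ, rfl⟩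
        exact ⟨σ.trans τ, by rw [← Finsupp.mapDomain_comp]; rfl⟩ }

abbrev Orbit : Type := Quotient orbitSetoid

theorem coeff_orbit {F : MvPowerSeries ℕ K} (hF : F ∈ SymSeries K) {d e : ℕ →₀ ℕ}
    (h : (Quotient.mk orbitSetoid d) = Quotient.mk orbitSetoid e) : F.coeff d = F.coeff e := by
  obtain ⟨σ, rfl⟩ := Quotient.exact h
  exact (coeff_perm hF σ d).symm

theorem coeff_inXY_orbit {F : MvPowerSeries ℕ K} (hF : F ∈ SymSeries K) {d e d' e' : ℕ →₀ ℕ}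
    (h : (Quotient.mk orbitSetoid d) = Quotient.mk orbitSetoid d')
    (h' : (Quotient.mk orbitSetoid e) = Quotient.mk orbitSetoid e') :
    (inXY F).coeff (d.sumElim e) = (inXY F).coeff (d'.sumElim e') := by
  obtain ⟨σ, rfl⟩ := Quotient.exact h
  obtain ⟨τ, rfl⟩ := Quotient.exact h'
  exact (coeff_inXY_perm hF σ τ d e).symm

theorem degree_orbit {d e : ℕ →₀ ℕ}
    (h : (Quotient.mk orbitSetoid d) = Quotient.mk orbitSetoid e) : d.degree = e.degree := by
  obtain ⟨σ, rfl⟩ := Quotient.exact h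
  exact (Finsupp.degree_mapDomain σ d).symm

open Classical in
/-- The monomial symmetric function: the sum of all monomials in one orbit. -/
def msym (K : Type*) [CommRing K] (q : Orbit) : SymFun K :=
  ⟨fun d => if Quotient.mk orbitSetoid d = q then 1 else 0, by
    set F : MvPowerSeries ℕ K := fun d => if Quotient.mk orbitSetoid d = q then 1 else 0
    constructor
    · intro σ
      ext d
      obtain ⟨d, rfl⟩ : ∃ d', Finsupp.mapDomain σ d' = d := by
        refine ⟨d.mapDomain σ.symm, ?_⟩
        rw [← Finsupp.mapDomain_comp]
        convert! Finsupp.mapDomain_id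
        simp
      rw [coeff_rename_equiv]
      have : Quotient.mk orbitSetoid d = Quotient.mk orbitSetoid (d.mapDomain σ) :=
        Quotient.sound ⟨σ, rfl⟩
      change (if _ then (1 : K) else 0) = if _ then 1 else 0
      rw [this]
    · refine ⟨q.out.degree, fun d hd => if_neg fun h => ?_⟩
      rw [degree_orbit (h.trans (Quotient.out_eq q).symm)] at hd
      exact lt_irrefl _ hd⟩

open Classical in
theorem coeff_msym (q : Orbit) (d : ℕ →₀ ℕ) :
    MvPowerSeries.coeff d (msym K q : MvPowerSeries ℕ K) =
      if Quotient.mk orbitSetoid d = q then 1 else 0 := rfl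

theorem finite_orbits (N : ℕ) : {q : Orbit | q.out.degree ≤ N}.Finite := by
  have hfin : (⋃ n ∈ Finset.range (N + 1),
      (((Finset.range N).finsuppAntidiag n : Finset (ℕ →₀ ℕ)) : Set (ℕ →₀ ℕ))).Finite :=
    Set.Finite.biUnion (Finset.finite_toSet _) fun _ _ => Finset.finite_toSet _
  refine (hfin.image (Quotient.mk orbitSetoid)).subset fun q hq => ?_
  set d := q.out with hd
  have hq' : d.degree ≤ N := hq
  have hcard : d.support.card ≤ N := by
    refine le_trans ?_ hq'
    rw [Finsupp.degree_apply, Finset.card_eq_sum_ones]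
    exact Finset.sum_le_sum fun i hi => Nat.one_le_iff_ne_zero.2 (Finsupp.mem_support_iff.1 hi)
  let a : Fin d.support.card ↪ ℕ :=
    d.support.equivFin.symm.toEmbedding.trans (Function.Embedding.subtype _)
  have := Equiv.Perm.isMultiplyPretransitive ℕ d.support.card
  obtain ⟨σ, hσ⟩ := MulAction.exists_smul_eq (Equiv.Perm ℕ) a Fin.valEmbedding
  refine ⟨d.mapDomain σ, ?_, ?_⟩
  · simp only [Set.mem_iUnion, Finset.mem_coe, Finset.mem_finsuppAntidiag]
    refine ⟨d.degree, by simpa [Nat.lt_succ_iff] using hq', ?_⟩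
    have hs : (d.mapDomain σ).support ⊆ Finset.range N := by
      refine Finsupp.mapDomain_support.trans fun x hx => ?_
      obtain ⟨i, hi, rfl⟩ := Finset.mem_image.1 hx
      have := DFunLike.congr_fun hσ (d.support.equivFin ⟨i, hi⟩)
      have h2 : σ i = (d.support.equivFin ⟨i, hi⟩ : ℕ) := by
        simpa [a] using this
      rw [h2, Finset.mem_range]
      exact (Fin.is_lt _).trans_le hcard
    refine ⟨?_, hs⟩
    rw [← Finsupp.degree_mapDomain σ d, Finsupp.degree_apply]
    exact (Finset.sum_subset hs fun i _ hi => by simpa using hi).symm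
  · rw [← Quotient.out_eq q]
    exact (Quotient.sound ⟨σ, rfl⟩ : Quotient.mk orbitSetoid d = _).symm

theorem linearIndependent_msym : LinearIndependent K (msym K) := by
  rw [linearIndependent_iff]
  intro l hl
  ext q
  have := congrArg (fun f : SymFun K => MvPowerSeries.coeff q.out (f : MvPowerSeries ℕ K)) hl
  simp only [Finsupp.linearCombination_apply, Finsupp.sum, AddSubmonoidClass.coe_finsetSum,
    Subalgebra.coe_smul, map_sum, map_smul, coeff_msym, Quotient.out_eq] at this
  simpa [Finsupp.sum] using this

theorem span_msym : (⊤ : Submodule K (SymFun K)) ≤ Submodule.span K (Set.range (msym K)) := by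
  rintro ⟨f, hf, N, hN⟩ -
  have h : (⟨f, hf, N, hN⟩ : SymFun K) =
      ∑ q ∈ (finite_orbits N).toFinset, f.coeff q.out • msym K q := by
    classical
    apply Subtype.ext
    ext d
    simp only [AddSubmonoidClass.coe_finsetSum, Subalgebra.coe_smul, map_sum, map_smul, coeff_msym,
      smul_eq_mul, mul_ite, mul_one, mul_zero, Finset.sum_ite_eq, Set.Finite.mem_toFinset,
      Set.mem_ofPred_eq]
    have hd : Quotient.mk orbitSetoid (Quotient.mk orbitSetoid d).out = Quotient.mk orbitSetoid d :=
      Quotient.out_eq _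
    split_ifs with h
    · exact (coeff_orbit hf hd).symm
    · rw [degree_orbit hd] at h
      exact hN d (not_le.1 h)
  rw [h]
  exact Submodule.sum_mem _ fun q _ => Submodule.smul_mem _ _ (Submodule.subset_span ⟨q, rfl⟩)

/-- The basis of monomial symmetric functions. -/
def msymBasis (K : Type*) [CommRing K] : Module.Basis Orbit K (SymFun K) :=
  Module.Basis.mk linearIndependent_msym span_msym

/-- The map from the tensor product `Λ(x) ⊗ Λ(y)` to the power series in `x` and `y`,
`f ⊗ g ↦ f(x) g(y)`. -/
def tensorToXY (K : Type*) [CommRing K] :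
    SymFun K ⊗[K] SymFun K →ₐ[K] MvPowerSeries (ℕ ⊕ ℕ) K :=
  Algebra.TensorProduct.productMap (inX.comp (SymFun K).val) (inY.comp (SymFun K).val)

theorem tensorToXY_tmul (f g : SymFun K) : tensorToXY K (f ⊗ₜ g) = inX f.1 * inY g.1 :=
  Algebra.TensorProduct.productMap_apply_tmul _ _ _ _

theorem tensorToXY_injective : Function.Injective (tensorToXY K) := by
  classical
  let b := (msymBasis K).tensorProduct (msymBasis K)
  have hc : ∀ p : Orbit × Orbit, (MvPowerSeries.coeff (p.1.out.sumElim p.2.out)).comp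
      (tensorToXY K).toLinearMap = b.coord p := by
    intro p
    refine b.ext fun r => ?_
    rw [Module.Basis.coord_apply, Module.Basis.repr_self, LinearMap.comp_apply,
      AlgHom.toLinearMap_apply, Module.Basis.tensorProduct_apply, tensorToXY_tmul,
      coeff_inX_mul_inY, msymBasis, Module.Basis.mk_apply, Module.Basis.mk_apply, coeff_msym,
      coeff_msym, Quotient.out_eq, Quotient.out_eq, Finsupp.single_apply]
    rcases p with ⟨p1, p2⟩
    rcases r with ⟨r1, r2⟩
    simp only [Prod.mk.injEq, ← ite_and, mul_ite, mul_one, mul_zero, eq_comm]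
    congr 1
    simp [and_comm]
  rw [injective_iff_map_eq_zero]
  intro t ht
  refine b.repr.injective (Finsupp.ext fun p => ?_)
  rw [map_zero, Finsupp.zero_apply, ← Module.Basis.coord_apply, ← hc p, LinearMap.comp_apply,
    AlgHom.toLinearMap_apply, ht, map_zero]

theorem inXY_mem_range (f : SymFun K) : inXY f.1 ∈ (tensorToXY K).range := by
  classical
  obtain ⟨f, hf, N, hN⟩ := f
  let S := (finite_orbits N).toFinset
  refine ⟨∑ p ∈ S ×ˢ S, (inXY f).coeff (p.1.out.sumElim p.2.out) • (msym K p.1 ⊗ₜ[K] msym K p.2), ?_⟩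
  have hbig : ∀ d e : ℕ →₀ ℕ, N < d.degree + e.degree → (inXY f).coeff (d.sumElim e) = 0 := by
    intro d e h
    have h1 : ((d.sumElim e).mapDomain Equiv.natSumNatEquivNat).mapDomain
        Equiv.natSumNatEquivNat.symm = d.sumElim e := by
      rw [← Finsupp.mapDomain_comp]
      rw [Equiv.symm_comp_self, Finsupp.mapDomain_id]
    rw [← h1, inXY, coeff_rename_equiv]
    refine hN _ ?_
    rwa [Finsupp.degree_mapDomain, Finsupp.sumElim_eq_add, map_add, Finsupp.degree_mapDomain,
      Finsupp.degree_mapDomain]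
  ext u
  obtain ⟨d, e, rfl⟩ : ∃ d e : ℕ →₀ ℕ, d.sumElim e = u := by
    refine ⟨u.comapDomain Sum.inl Sum.inl_injective.injOn,
      u.comapDomain Sum.inr Sum.inr_injective.injOn, ?_⟩
    ext (i | i) <;> rfl
  have hd : Quotient.mk orbitSetoid (Quotient.mk orbitSetoid d).out = Quotient.mk orbitSetoid d :=
    Quotient.out_eq _
  have he : Quotient.mk orbitSetoid (Quotient.mk orbitSetoid e).out = Quotient.mk orbitSetoid e :=
    Quotient.out_eq _
  change MvPowerSeries.coeff _ (tensorToXY K _) = _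
  simp only [map_sum, map_smul, tensorToXY_tmul, coeff_inX_mul_inY, coeff_msym, smul_eq_mul]
  have hp : ∀ p ∈ S ×ˢ S, ((inXY f).coeff (p.1.out.sumElim p.2.out) *
      ((if Quotient.mk orbitSetoid d = p.1 then 1 else 0) *
        (if Quotient.mk orbitSetoid e = p.2 then 1 else 0))) =
      if (Quotient.mk orbitSetoid d, Quotient.mk orbitSetoid e) = p then
        (inXY f).coeff (p.1.out.sumElim p.2.out) else 0 := by
    rintro ⟨p, q⟩ -
    simp only [Prod.mk.injEq, ite_and, mul_ite, mul_one, mul_zero]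
    split_ifs <;> rfl
  rw [Finset.sum_congr rfl hp, Finset.sum_ite_eq]
  have hde := coeff_inXY_orbit hf hd he
  split_ifs with h
  · exact hde
  · refine (hbig d e ?_).symm
    simp only [Finset.mem_product, S, Set.Finite.mem_toFinset, Set.mem_ofPred_eq,
      degree_orbit hd, degree_orbit he] at h
    omega

/-- The coproduct of symmetric functions: `f(x) ↦ f(x, y)`,
viewed in the tensor product `Λ(x) ⊗ Λ(y)`. -/
def coproduct (K : Type*) [CommRing K] : SymFun K →ₐ[K] SymFun K ⊗[K] SymFun K :=
  (AlgEquiv.ofInjective (tensorToXY K) tensorToXY_injective).symm.toAlgHom.comp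
    ((inXY.comp (SymFun K).val).codRestrict (tensorToXY K).range inXY_mem_range)

theorem tensorToXY_coproduct (f : SymFun K) : tensorToXY K (coproduct K f) = inXY f.1 := by
  exact congrArg Subtype.val ((AlgEquiv.ofInjective (tensorToXY K) tensorToXY_injective).apply_symm_apply
    ⟨inXY f.1, inXY_mem_range f⟩)

/-- The map `F^⊥ = ((F, -) ⊗ id) ∘ Δ`, that is `f ↦ ∑ (F, f₁) f₂` where `Δ f = ∑ f₁ ⊗ f₂`. -/
def perp (F : SymSeries K) : SymFun K →ₗ[K] SymFun K :=
  (TensorProduct.lid K (SymFun K)).toLinearMap ∘ₗ (hall F).rTensor (SymFun K) ∘ₗ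
    (coproduct K).toLinearMap

/-- `F` is group-like: `F(x, y) = F(x) F(y)` and `F(0) = 1`. -/
def IsGroupLike (F : SymSeries K) : Prop :=
  inXY F.1 = inX F.1 * inY F.1 ∧ MvPowerSeries.constantCoeff F.1 = 1

end TwoSets

end SymmFn

end

/-!
Write `h_d` for the product of the complete homogeneous symmetric functions `h_{d i}`. Its expansion
in Schur functions is `h_d = ∑ K_{lam, d} s_lam` with `K_{lam, d} = [x^d] s_lam`, so that
`(F, h_d) = [x^d] F` for every symmetric series `F`; the `h_d` span `Λ` because the Kostka matrices
are invertible. Hence `[x^d y^e] F(x, y) = (F, h_d h_e)`, while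
`[x^d y^e] F(x) F(y) = (F, h_d) (F, h_e)`, and `F` is group-like if and only if `(F, -)` is
multiplicative and unital.

The functional `(F, -)` is the constant term of `F^⊥`, so it is multiplicative if `F^⊥` is.
Conversely, if `(F, -)` is an algebra homomorphism then so is `F^⊥`, and as `F(0) = 1` it is the
identity up to terms of lower degree, hence bijective.

The expansion of `h_d` comes from the Pieri rule `h_a s_lam = ∑ s_nu`, over the `nu` obtained from
`lam` by adding a horizontal strip of size `a`. Comparing the coefficients of the powers of the last
variable on both sides, the Pieri rule reduces to a bijection between the ways to add and then
remove a horizontal strip and the ways to remove and then add one: a local growth rule, obtained by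
reflecting each row length in the interval that the neighbouring rows allow.
-/

noncomputable section

namespace SymmFn

/-! ### Horizontal strips -/

theorem rowLen_injective : Function.Injective YoungDiagram.rowLen :=
  fun _ _ h => expo_injective (Finsupp.ext (congrFun h))

theorem exists_rowLen_eq_zero (lam : YoungDiagram) : ∃ N, lam.rowLen N = 0 :=
  (Infinite.exists_notMem_finset (expo lam).support).imp fun _ => Finsupp.notMem_support_iff.1

theorem card_eq_sum_rowLen {lam : YoungDiagram} {N : ℕ} (h : lam.rowLen N = 0) :
    lam.card = ∑ i ∈ Finset.range N, lam.rowLen i := by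
  rw [← degree_expo, Finsupp.degree_apply]
  refine Finset.sum_subset (fun i hi => ?_) fun i _ hi => by simpa using hi
  by_contra hN
  have hi0 := lam.rowLen_anti N i (by simpa using hN)
  exact Finsupp.mem_support_iff.1 hi (Nat.le_zero.1 (hi0.trans h.le))

/-- The diagram with the row lengths `f 0 ≥ f 1 ≥ ⋯`. -/
def ofRowLen (f : ℕ → ℕ) (hf : Antitone f) (h0 : ∃ N, f N = 0) : YoungDiagram :=
  YoungDiagram.ofRowLens ((List.range (Nat.find h0)).map f)
    (List.pairwise_le_range.map (S := (· ≥ ·)) f fun _ _ h => hf h).sortedGE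

theorem rowLen_ofRowLen {f : ℕ → ℕ} (hf : Antitone f) (h0 : ∃ N, f N = 0) :
    (ofRowLen f hf h0).rowLen = f := by
  refine funext fun i => eq_of_forall_lt_iff fun j => ?_
  have hpos (hj : j < f i) (m : ℕ) (hm : m ≤ i) : f m ≠ 0 := (hj.trans_le (hf hm)).ne_bot
  rw [← YoungDiagram.mem_iff_lt_rowLen, ofRowLen, YoungDiagram.mem_ofRowLens]
  simpa using hpos

/-- The interlacing `g 0 ≥ f 0 ≥ g 1 ≥ f 1 ≥ ⋯` of two sequences. -/
def Interlace (f g : ℕ → ℕ) : Prop :=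
  ∀ i, g (i + 1) ≤ f i ∧ f i ≤ g i

namespace Interlace

variable {f g : ℕ → ℕ}

theorem antitone_left (h : Interlace f g) : Antitone f :=
  antitone_nat_of_succ_le fun i => (h (i + 1)).2.trans (h i).1

theorem antitone_right (h : Interlace f g) : Antitone g :=
  antitone_nat_of_succ_le fun i => (h i).1.trans (h i).2

theorem exists_left_eq_zero (h : Interlace f g) : (∃ N, g N = 0) → ∃ N, f N = 0 :=
  Exists.imp fun N hN => Nat.le_zero.1 ((h N).2.trans hN.le)

theorem exists_right_eq_zero (h : Interlace f g) : (∃ N, f N = 0) → ∃ N, g N = 0 :=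
  fun ⟨N, hN⟩ => ⟨N + 1, Nat.le_zero.1 ((h N).1.trans hN.le)⟩

end Interlace

/-- `mu` is contained in `lam`, and `lam / mu` is a horizontal strip. -/
def IsHorizontalStrip (mu lam : YoungDiagram) : Prop :=
  Interlace mu.rowLen lam.rowLen

theorem isHorizontalStrip_iff_mem {mu lam : YoungDiagram} : IsHorizontalStrip mu lam ↔
    ∀ i j, ((i + 1, j) ∈ lam → (i, j) ∈ mu) ∧ ((i, j) ∈ mu → (i, j) ∈ lam) := by
  simp only [YoungDiagram.mem_iff_lt_rowLen, IsHorizontalStrip, Interlace]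
  refine forall_congr' fun i => ?_
  rw [forall_and, ← forall_lt_iff_le, ← forall_lt_iff_le]

theorem IsHorizontalStrip.le {mu lam : YoungDiagram} (h : IsHorizontalStrip mu lam) : mu ≤ lam :=
  fun c hc => (isHorizontalStrip_iff_mem.1 h c.1 c.2).2 hc

theorem IsHorizontalStrip.card_le {mu lam : YoungDiagram} (h : IsHorizontalStrip mu lam) :
    mu.card ≤ lam.card :=
  Finset.card_le_card h.le

/-- The diagrams with `n` cells. -/
def diagrams (n : ℕ) : Finset YoungDiagram :=
  Finset.univ.map (Function.Embedding.subtype fun lam : YoungDiagram => lam.card = n)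

theorem mem_diagrams {n : ℕ} {lam : YoungDiagram} : lam ∈ diagrams n ↔ lam.card = n := by
  simp [diagrams]

open Classical in
/-- The diagrams obtained from `lam` by adding a horizontal strip of size `k`. -/
def above (lam : YoungDiagram) (k : ℕ) : Finset YoungDiagram :=
  {mu ∈ diagrams (lam.card + k) | IsHorizontalStrip lam mu}

open Classical in
/-- The diagrams obtained from `lam` by removing a horizontal strip of size `k`. -/
def below (lam : YoungDiagram) (k : ℕ) : Finset YoungDiagram :=
  {mu ∈ diagrams (lam.card - k) | lam ∈ above mu k}

theorem mem_above {lam mu : YoungDiagram} {k : ℕ} :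
    mu ∈ above lam k ↔ mu.card = lam.card + k ∧ IsHorizontalStrip lam mu := by
  simp [above, mem_diagrams]

theorem mem_below_iff_mem_above {lam mu : YoungDiagram} {k : ℕ} :
    mu ∈ below lam k ↔ lam ∈ above mu k := by
  simp only [below, Finset.mem_filter, mem_diagrams, and_iff_right_iff_imp]
  intro h
  have := (mem_above.1 h).1
  omega

theorem mem_below {lam mu : YoungDiagram} {k : ℕ} :
    mu ∈ below lam k ↔ lam.card = mu.card + k ∧ IsHorizontalStrip mu lam := by
  rw [mem_below_iff_mem_above, mem_above]

/-! ### The local growth rule -/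

section Growth

/-- The `i`-th entry of `f` lies between `max (l (i + 1)) (m (i + 1))` and `min (l i) (m i)`. Both
the sequences interlacing `l` and `m` from below and those interlacing them from above, up to their
first entry, are of this form; the local growth rule exchanges the two. -/
def Between (l m f : ℕ → ℕ) : Prop :=
  ∀ i, max (l (i + 1)) (m (i + 1)) ≤ f i ∧ f i ≤ min (l i) (m i)

/-- The reflection of the `i`-th entry of `f` in the interval from `max (l (i + 1)) (m (i + 1))` to
`min (l i) (m i)`. -/
def reflect (l m f : ℕ → ℕ) (i : ℕ) : ℕ :=
  max (l (i + 1)) (m (i + 1)) + min (l i) (m i) - f i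

/-- The sequence starting with `max (l 0) (m 0) + k` and continuing with the reflected entries of
`f`. -/
def growUp (l m f : ℕ → ℕ) (k : ℕ) : ℕ → ℕ
  | 0 => max (l 0) (m 0) + k
  | i + 1 => reflect l m f i

variable {l m f g : ℕ → ℕ}

theorem interlace_and_iff_between : Interlace f l ∧ Interlace f m ↔ Between l m f := by
  simp only [Interlace, Between, ← forall_and, max_le_iff, le_min_iff]
  exact forall_congr' fun i => by tauto

theorem interlace_and_iff_between_tail :
    Interlace l g ∧ Interlace m g ↔ max (l 0) (m 0) ≤ g 0 ∧ Between l m fun i => g (i + 1) := by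
  simp only [Interlace, Between, forall_and, max_le_iff, le_min_iff,
    ← Nat.and_forall_add_one (p := fun i => l i ≤ g i),
    ← Nat.and_forall_add_one (p := fun i => m i ≤ g i)]
  tauto

theorem Between.reflect_add (h : Between l m f) (i : ℕ) :
    reflect l m f i + f i = max (l (i + 1)) (m (i + 1)) + min (l i) (m i) :=
  Nat.sub_add_cancel ((h i).2.trans le_add_self)

theorem Between.reflect (h : Between l m f) : Between l m (reflect l m f) := fun i => by
  have := h.reflect_add i
  have := h i
  omega

theorem Between.reflect_reflect (h : Between l m f) :
    SymmFn.reflect l m (SymmFn.reflect l m f) = f := funext fun i => by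
  have := h.reflect_add i
  have := h.reflect.reflect_add i
  omega

theorem interlace_reflect (hl : Interlace l g) (hm : Interlace m g) :
    Interlace (reflect l m fun i => g (i + 1)) l ∧ Interlace (reflect l m fun i => g (i + 1)) m :=
  interlace_and_iff_between.2 (interlace_and_iff_between_tail.1 ⟨hl, hm⟩).2.reflect

theorem interlace_growUp (hl : Interlace f l) (hm : Interlace f m) (k : ℕ) :
    Interlace l (growUp l m f k) ∧ Interlace m (growUp l m f k) :=
  interlace_and_iff_between_tail.2
    ⟨Nat.le_add_right _ k, (interlace_and_iff_between.1 ⟨hl, hm⟩).reflect⟩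

theorem growUp_reflect (hl : Interlace l g) (hm : Interlace m g) :
    growUp l m (reflect l m fun i => g (i + 1)) (g 0 - max (l 0) (m 0)) = g := by
  obtain ⟨h0, h⟩ := interlace_and_iff_between_tail.1 ⟨hl, hm⟩
  funext i
  cases i with
  | zero => exact Nat.add_sub_of_le h0
  | succ i => exact congrFun h.reflect_reflect i

theorem reflect_growUp (hl : Interlace f l) (hm : Interlace f m) (k : ℕ) :
    (reflect l m fun i => growUp l m f k (i + 1)) = f :=
  (interlace_and_iff_between.1 ⟨hl, hm⟩).reflect_reflect

/-- The local growth rule: the diagrams from which both `lam` and `mu` arise by removing a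
horizontal strip correspond to pairs of the excess in the first row and a diagram from which `lam`
and `mu` arise by adding a horizontal strip. -/
def growth (lam mu : YoungDiagram) :
    {nu // IsHorizontalStrip lam nu ∧ IsHorizontalStrip mu nu} ≃
      ℕ × {kap // IsHorizontalStrip kap lam ∧ IsHorizontalStrip kap mu} where
  toFun nu := (nu.1.rowLen 0 - max (lam.rowLen 0) (mu.rowLen 0),
    have h := interlace_reflect nu.2.1 nu.2.2
    ⟨ofRowLen _ h.1.antitone_left (h.1.exists_left_eq_zero (exists_rowLen_eq_zero lam)),
      by simpa only [IsHorizontalStrip, rowLen_ofRowLen] using h⟩)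
  invFun p :=
    have h := interlace_growUp p.2.2.1 p.2.2.2 p.1
    ⟨ofRowLen _ h.1.antitone_right (h.1.exists_right_eq_zero (exists_rowLen_eq_zero lam)),
      by simpa only [IsHorizontalStrip, rowLen_ofRowLen] using h⟩
  left_inv nu := Subtype.ext <| rowLen_injective <| by
    simp only [rowLen_ofRowLen, growUp_reflect nu.2.1 nu.2.2]
  right_inv p := Prod.ext (by simp only [rowLen_ofRowLen, growUp, Nat.add_sub_cancel_left]) <|
    Subtype.ext <| rowLen_injective <| by
      simp only [rowLen_ofRowLen, reflect_growUp p.2.2.1 p.2.2.2]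

theorem card_add_card_of_growUp {lam mu nu kap : YoungDiagram} {k : ℕ}
    (hl : IsHorizontalStrip kap lam) (hm : IsHorizontalStrip kap mu)
    (h : nu.rowLen = growUp lam.rowLen mu.rowLen kap.rowLen k) :
    nu.card + kap.card = lam.card + mu.card + k := by
  obtain ⟨N, hlN, hmN⟩ : ∃ N, lam.rowLen N = 0 ∧ mu.rowLen N = 0 := by
    obtain ⟨N, hN⟩ := exists_rowLen_eq_zero lam
    obtain ⟨M, hM⟩ := exists_rowLen_eq_zero mu
    exact ⟨max N M, Nat.le_zero.1 ((lam.rowLen_anti _ _ (le_max_left _ _)).trans hN.le),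
      Nat.le_zero.1 ((mu.rowLen_anti _ _ (le_max_right _ _)).trans hM.le)⟩
  have hb := interlace_and_iff_between.1 ⟨hl, hm⟩
  have hkN : kap.rowLen N = 0 := Nat.le_zero.1 ((hl N).2.trans hlN.le)
  have hnN : nu.rowLen (N + 1) = 0 := by
    rw [h]
    exact Nat.le_zero.1 ((hb.reflect N).2.trans ((min_le_left _ _).trans hlN.le))
  have hadd (i : ℕ) : nu.rowLen (i + 1) + kap.rowLen i =
      max (lam.rowLen (i + 1)) (mu.rowLen (i + 1)) + min (lam.rowLen i) (mu.rowLen i) := by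
    rw [h]
    exact hb.reflect_add i
  have hmax : ∑ i ∈ Finset.range N, max (lam.rowLen (i + 1)) (mu.rowLen (i + 1)) +
      max (lam.rowLen 0) (mu.rowLen 0) =
        ∑ i ∈ Finset.range N, max (lam.rowLen i) (mu.rowLen i) := by
    rw [← Finset.sum_range_succ' fun i => max (lam.rowLen i) (mu.rowLen i), Finset.sum_range_succ,
      hlN, hmN, max_self, add_zero]
  calc nu.card + kap.card
      = ∑ i ∈ Finset.range N, (nu.rowLen (i + 1) + kap.rowLen i) + nu.rowLen 0 := by
        rw [card_eq_sum_rowLen hnN, card_eq_sum_rowLen hkN, Finset.sum_range_succ',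
          Finset.sum_add_distrib, add_right_comm]
    _ = ∑ i ∈ Finset.range N, max (lam.rowLen (i + 1)) (mu.rowLen (i + 1)) +
          max (lam.rowLen 0) (mu.rowLen 0) +
          ∑ i ∈ Finset.range N, min (lam.rowLen i) (mu.rowLen i) + k := by
        rw [Finset.sum_congr rfl fun i _ => hadd i, Finset.sum_add_distrib, h, growUp]
        ring
    _ = lam.card + mu.card + k := by
        rw [hmax, ← Finset.sum_add_distrib, card_eq_sum_rowLen hlN, card_eq_sum_rowLen hmN,
          ← Finset.sum_add_distrib]
        simp only [max_add_min]

theorem card_add_card_growth_symm {lam mu : YoungDiagram}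
    (p : ℕ × {kap // IsHorizontalStrip kap lam ∧ IsHorizontalStrip kap mu}) :
    ((growth lam mu).symm p).1.card + p.2.1.card = lam.card + mu.card + p.1 :=
  have h := interlace_growUp p.2.2.1 p.2.2.2 p.1
  card_add_card_of_growUp p.2.2.1 p.2.2.2 (rowLen_ofRowLen h.1.antitone_right _)

theorem card_add_card_growth {lam mu : YoungDiagram}
    (nu : {nu // IsHorizontalStrip lam nu ∧ IsHorizontalStrip mu nu}) :
    nu.1.card + (growth lam mu nu).2.1.card = lam.card + mu.card + (growth lam mu nu).1 := by
  simpa using card_add_card_growth_symm (growth lam mu nu)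

/-- The relation `h_b^⊥ h_a = ∑_k h_{a-k} h_{b-k}^⊥` between the multiplication operators `h_a` and
their adjoints `h_b^⊥`, in terms of the indices of Schur functions. -/
theorem sum_above_below {M : Type*} [AddCommMonoid M] (lam : YoungDiagram) (a b : ℕ)
    (f : YoungDiagram → M) :
    ∑ nu ∈ above lam a, ∑ mu ∈ below nu b, f mu =
      ∑ p ∈ Finset.HasAntidiagonal.antidiagonal b with p.1 ≤ a,
        ∑ kap ∈ below lam p.2, ∑ mu ∈ above kap (a - p.1), f mu := by
  simp only [Finset.sum_sigma']
  have hup {x : Σ _ : YoungDiagram, YoungDiagram}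
      (hx : x ∈ (above lam a).sigma fun nu => below nu b) :
      IsHorizontalStrip lam x.1 ∧ IsHorizontalStrip x.2 x.1 := by
    simp only [Finset.mem_sigma, mem_above, mem_below] at hx
    exact ⟨hx.1.2, hx.2.2⟩
  have hdown {y : Σ _ : ℕ × ℕ, Σ _ : YoungDiagram, YoungDiagram}
      (hy : y ∈ {p ∈ Finset.HasAntidiagonal.antidiagonal b | p.1 ≤ a}.sigma fun p =>
        (below lam p.2).sigma fun kap => above kap (a - p.1)) :
      IsHorizontalStrip y.2.1 lam ∧ IsHorizontalStrip y.2.1 y.2.2 := by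
    simp only [Finset.mem_sigma, mem_above, mem_below] at hy
    exact ⟨hy.2.1.2, hy.2.2.2⟩
  refine Finset.sum_bij'
    (fun x hx => let p := growth lam x.2 ⟨x.1, hup hx⟩; ⟨(p.1, b - p.1), p.2, x.2⟩)
    (fun y hy => ⟨(growth lam y.2.2).symm (y.1.1, ⟨y.2.1, hdown hy⟩), y.2.2⟩)
    (fun x hx => ?_) (fun y hy => ?_) (fun x _ => by simp) (fun y hy => ?_) fun _ _ => rfl
  · have hcard := card_add_card_growth ⟨x.1, hup hx⟩
    have hstrip := (growth lam x.2 ⟨x.1, hup hx⟩).2.2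
    have hle := hstrip.1.card_le
    have hle' := hstrip.2.card_le
    simp only [Finset.mem_sigma, mem_above, mem_below, Finset.mem_filter,
      Finset.HasAntidiagonal.mem_antidiagonal] at hx hcard ⊢
    exact ⟨by omega, ⟨by omega, hstrip.1⟩, by omega, hstrip.2⟩
  · have hcard := card_add_card_growth_symm (y.1.1, ⟨y.2.1, hdown hy⟩)
    have hstrip := ((growth lam y.2.2).symm (y.1.1, ⟨y.2.1, hdown hy⟩)).2
    simp only [Finset.mem_sigma, mem_above, mem_below, Finset.mem_filter,
      Finset.HasAntidiagonal.mem_antidiagonal] at hy hcard ⊢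
    exact ⟨⟨by omega, hstrip.1⟩, by omega, hstrip.2⟩
  · have hp := (Finset.mem_filter.1 (Finset.mem_sigma.1 hy).1).1
    have hj : b - y.1.1 = y.1.2 := by
      rw [← Finset.HasAntidiagonal.mem_antidiagonal.1 hp, Nat.add_sub_cancel_left]
    simp [hj]

end Growth

/-! ### The branching rule for semistandard tableaux -/

section Tableaux

variable {lam mu : YoungDiagram}

theorem content_apply (T : SemistandardYoungTableau lam) (k : ℕ) :
    content T k = (lam.cells.filter fun c => T c.1 c.2 = k).card := by
  rw [content, Finsupp.finsetSum_apply, Finset.card_filter]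
  exact Finset.sum_congr rfl fun c _ => by rw [Finsupp.single_apply]

theorem entry_mem_support_content (T : SemistandardYoungTableau lam) {i j : ℕ}
    (h : (i, j) ∈ lam) : T i j ∈ (content T).support := by
  rw [Finsupp.mem_support_iff, content_apply]
  exact Finset.card_ne_zero_of_mem (Finset.mem_filter.2 ⟨(YoungDiagram.mem_cells _).2 h, rfl⟩)

theorem degree_content (T : SemistandardYoungTableau lam) : (content T).degree = lam.card := by
  simp [content, YoungDiagram.card]

theorem finite_setOf_content_eq (lam : YoungDiagram) (d : ℕ →₀ ℕ) :
    {T : SemistandardYoungTableau lam | content T = d}.Finite := by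
  refine Set.Finite.of_injOn (f := fun T (c : lam.cells) => T c.1.1 c.1.2)
    (t := Set.pi Set.univ fun _ => (d.support : Set ℕ)) ?_ ?_
    (Set.Finite.pi fun _ => Finset.finite_toSet _)
  · rintro T rfl ⟨⟨i, j⟩, hc⟩ -
    exact entry_mem_support_content T ((YoungDiagram.mem_cells _).1 hc)
  · intro T _ T' _ h
    ext i j
    by_cases hc : (i, j) ∈ lam
    · exact congrFun h ⟨(i, j), (YoungDiagram.mem_cells _).2 hc⟩
    · rw [T.zeros hc, T'.zeros hc]

/-- The semistandard tableaux of shape `lam` and content `d`. -/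
def tableaux (lam : YoungDiagram) (d : ℕ →₀ ℕ) : Finset (SemistandardYoungTableau lam) :=
  (finite_setOf_content_eq lam d).toFinset

theorem mem_tableaux {d : ℕ →₀ ℕ} {T : SemistandardYoungTableau lam} :
    T ∈ tableaux lam d ↔ content T = d := by
  simp [tableaux]

theorem coeff_schur (K : Type*) [CommRing K] (lam : YoungDiagram) (d : ℕ →₀ ℕ) :
    (schur K lam).coeff d = ((tableaux lam d).card : K) := by
  change ((Nat.card {T | content T = d} : ℕ) : K) = _
  rw [Nat.card_coe_set_eq, Set.ncard_eq_toFinset_card _ (finite_setOf_content_eq lam d), tableaux]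

theorem coeff_schur_of_degree_ne (K : Type*) [CommRing K] {d : ℕ →₀ ℕ} (h : d.degree ≠ lam.card) :
    (schur K lam).coeff d = 0 := by
  rw [coeff_schur, Finset.card_eq_zero.2, Nat.cast_zero]
  refine Finset.eq_empty_of_forall_notMem fun T hT => h ?_
  rw [← mem_tableaux.1 hT, degree_content]

/-- The shape of the part of a tableau with entries less than `n`. -/
def lowerShape (T : SemistandardYoungTableau lam) (n : ℕ) : YoungDiagram where
  cells := lam.cells.filter fun c => T c.1 c.2 < n
  isLowerSet := by
    rintro ⟨i, j⟩ ⟨i', j'⟩ ⟨hi : i' ≤ i, hj : j' ≤ j⟩ hc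
    simp only [Finset.coe_filter, Set.mem_ofPred_eq, YoungDiagram.mem_cells] at hc ⊢
    refine ⟨lam.up_left_mem hi hj hc.1, lt_of_le_of_lt ?_ hc.2⟩
    exact (T.row_weak_of_le hj (lam.up_left_mem hi le_rfl hc.1)).trans (T.col_weak hi hc.1)

theorem mem_lowerShape {T : SemistandardYoungTableau lam} {n i j : ℕ} :
    (i, j) ∈ lowerShape T n ↔ (i, j) ∈ lam ∧ T i j < n := by
  rw [← YoungDiagram.mem_cells, lowerShape, Finset.mem_filter, YoungDiagram.mem_cells]

/-- The restriction of a tableau to a smaller diagram. -/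
def restrict (h : mu ≤ lam) (T : SemistandardYoungTableau lam) : SemistandardYoungTableau mu where
  entry i j := open Classical in if (i, j) ∈ mu then T i j else 0
  row_weak' hj hc := by
    rw [if_pos hc, if_pos (mu.up_left_mem le_rfl hj.le hc)]
    exact T.row_weak hj (h hc)
  col_strict' hi hc := by
    rw [if_pos hc, if_pos (mu.up_left_mem hi.le le_rfl hc)]
    exact T.col_strict hi (h hc)
  zeros' hc := if_neg hc

theorem restrict_apply_of_mem (h : mu ≤ lam) (T : SemistandardYoungTableau lam) {i j : ℕ}
    (hc : (i, j) ∈ mu) : restrict h T i j = T i j :=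
  if_pos hc

/-- The extension of a tableau with entries less than `n` by the entry `n` on a horizontal strip. -/
def extend (h : IsHorizontalStrip mu lam) (S : SemistandardYoungTableau mu) (n : ℕ)
    (hS : ∀ i j, (i, j) ∈ mu → S i j < n) : SemistandardYoungTableau lam where
  entry i j := open Classical in if (i, j) ∈ mu then S i j else if (i, j) ∈ lam then n else 0
  row_weak' {i j1 j2} hj hc := by
    by_cases h2 : (i, j2) ∈ mu
    · rw [if_pos h2, if_pos (mu.up_left_mem le_rfl hj.le h2)]
      exact S.row_weak hj h2
    · rw [if_neg h2, if_pos hc]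
      split_ifs with h3
      · exact (hS _ _ h3).le
      · exact le_rfl
      · exact Nat.zero_le _
  col_strict' {i1 i2 j} hi hc := by
    obtain ⟨i, rfl⟩ := Nat.exists_eq_add_one_of_ne_zero (Nat.ne_zero_of_lt hi)
    have h1 : (i1, j) ∈ mu :=
      mu.up_left_mem (Nat.lt_succ_iff.1 hi) le_rfl ((isHorizontalStrip_iff_mem.1 h _ _).1 hc)
    rw [if_pos h1]
    split_ifs with h3
    · exact S.col_strict hi h3
    · exact hS _ _ h1
  zeros' hc := by rw [if_neg fun h' => hc (h.le h'), if_neg hc]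

section Extend

variable {n : ℕ} (h : IsHorizontalStrip mu lam) (S : SemistandardYoungTableau mu)
  (hS : ∀ i j, (i, j) ∈ mu → S i j < n)

theorem extend_apply_of_mem {i j : ℕ} (hc : (i, j) ∈ mu) : extend h S n hS i j = S i j :=
  if_pos hc

theorem extend_apply_of_notMem {i j : ℕ} (hc : (i, j) ∈ lam) (hc' : (i, j) ∉ mu) :
    extend h S n hS i j = n :=
  (if_neg hc').trans (if_pos hc)

theorem restrict_extend : restrict h.le (extend h S n hS) = S := by
  ext i j
  by_cases hc : (i, j) ∈ mu
  · rw [restrict_apply_of_mem _ _ hc, extend_apply_of_mem _ _ _ hc]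
  · rw [SemistandardYoungTableau.zeros _ hc, SemistandardYoungTableau.zeros _ hc]

theorem lowerShape_extend : lowerShape (extend h S n hS) n = mu := by
  ext ⟨i, j⟩
  rw [YoungDiagram.mem_cells, YoungDiagram.mem_cells, mem_lowerShape]
  by_cases hc : (i, j) ∈ mu
  · simp [hc, h.le hc, extend_apply_of_mem, hS i j hc]
  · simp +contextual [hc, extend_apply_of_notMem]

theorem content_extend {k : ℕ} (hk : lam.card = mu.card + k) :
    content (extend h S n hS) = content S + Finsupp.single n k := by
  have hstrip : ∑ c ∈ lam.cells \ mu.cells, Finsupp.single (extend h S n hS c.1 c.2) 1 =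
      Finsupp.single n k := by
    rw [Finset.sum_congr rfl (g := fun _ => Finsupp.single n 1), Finset.sum_const,
      Finset.card_sdiff_of_subset h.le, Finsupp.smul_single, smul_eq_mul, mul_one]
    · exact congrArg _ (Nat.sub_eq_of_eq_add' hk)
    · intro c hc
      rw [Finset.mem_sdiff, YoungDiagram.mem_cells, YoungDiagram.mem_cells] at hc
      rw [extend_apply_of_notMem _ _ _ hc.1 hc.2]
  rw [content, content, ← Finset.sum_sdiff h.le, hstrip, add_comm]
  congr 1
  exact Finset.sum_congr rfl fun c hc => by rw [extend_apply_of_mem _ _ _ hc]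

end Extend

section LowerShape

variable {n : ℕ} {T : SemistandardYoungTableau lam}

theorem card_lowerShape_add (hT : ∀ i j, (i, j) ∈ lam → T i j ≤ n) :
    (lowerShape T n).card + content T n = lam.card := by
  rw [content_apply, YoungDiagram.card, YoungDiagram.card, lowerShape,
    ← Finset.card_filter_add_card_filter_not (s := lam.cells) fun c => T c.1 c.2 < n]
  congr 2
  refine Finset.filter_congr fun c hc => ?_
  have := hT c.1 c.2 hc
  omega

theorem isHorizontalStrip_lowerShape (hT : ∀ i j, (i, j) ∈ lam → T i j ≤ n) :
    IsHorizontalStrip (lowerShape T n) lam :=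
  isHorizontalStrip_iff_mem.2 fun i _ => ⟨fun h => mem_lowerShape.2
    ⟨lam.up_left_mem (Nat.le_succ i) le_rfl h,
      (T.col_strict (Nat.lt_succ_self i) h).trans_le (hT _ _ h)⟩, fun h => (mem_lowerShape.1 h).1⟩

theorem restrict_lowerShape_lt (h : lowerShape T n ≤ lam) (i j : ℕ)
    (hc : (i, j) ∈ lowerShape T n) : restrict h T i j < n := by
  rw [restrict_apply_of_mem h T hc]
  exact (mem_lowerShape.1 hc).2

theorem extend_restrict (hT : ∀ i j, (i, j) ∈ lam → T i j ≤ n)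
    (h : IsHorizontalStrip (lowerShape T n) lam) :
    extend h (restrict h.le T) n (restrict_lowerShape_lt h.le) = T := by
  ext i j
  by_cases hc : (i, j) ∈ lam
  · by_cases hc' : (i, j) ∈ lowerShape T n
    · rw [extend_apply_of_mem _ _ _ hc', restrict_apply_of_mem _ _ hc']
    · rw [extend_apply_of_notMem _ _ _ hc hc']
      exact ((hT i j hc).eq_of_not_lt fun hlt => hc' (mem_lowerShape.2 ⟨hc, hlt⟩)).symm
  · rw [T.zeros hc, SemistandardYoungTableau.zeros _ hc]

end LowerShape

end Tableaux

section Branching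

variable {lam : YoungDiagram} {q : ℕ →₀ ℕ} {n : ℕ}

theorem entry_lt_of_content_eq (hq : ∀ i ∈ q.support, i < n) {T : SemistandardYoungTableau lam}
    (hT : content T = q) (i j : ℕ) (hc : (i, j) ∈ lam) : T i j < n :=
  hq _ (hT ▸ entry_mem_support_content T hc)

theorem entry_le_of_content_eq_add_single (hq : ∀ i ∈ q.support, i < n) {k : ℕ}
    {T : SemistandardYoungTableau lam} (hT : content T = q + Finsupp.single n k) (i j : ℕ)
    (hc : (i, j) ∈ lam) : T i j ≤ n := by
  classical
  have hmem := Finsupp.support_add (hT ▸ entry_mem_support_content T hc)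
  rcases Finset.mem_union.1 hmem with h | h
  · exact (hq _ h).le
  · exact (Finset.mem_singleton.1 (Finsupp.support_single_subset h)).le

theorem lowerShape_mem_below (hq : ∀ i ∈ q.support, i < n) {k : ℕ}
    {T : SemistandardYoungTableau lam} (hT : content T = q + Finsupp.single n k) :
    lowerShape T n ∈ below lam k := by
  have hle := entry_le_of_content_eq_add_single hq hT
  refine mem_below.2 ⟨?_, isHorizontalStrip_lowerShape hle⟩
  have hqn : q n = 0 := Finsupp.notMem_support_iff.1 fun h => (hq n h).false
  rw [← card_lowerShape_add hle, hT, Finsupp.add_apply, hqn, zero_add, Finsupp.single_eq_same]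

theorem card_tableaux_add_single (hq : ∀ i ∈ q.support, i < n) (k : ℕ) :
    (tableaux lam (q + Finsupp.single n k)).card = ∑ mu ∈ below lam k, (tableaux mu q).card := by
  classical
  rw [Finset.card_eq_sum_card_fiberwise (f := fun T => lowerShape T n) (t := below lam k)
    fun T hT => lowerShape_mem_below hq (mem_tableaux.1 hT)]
  refine Finset.sum_congr rfl fun mu hmu => ?_
  obtain ⟨hk, hs⟩ := mem_below.1 hmu
  have hlt {S} (hS : S ∈ tableaux mu q) := entry_lt_of_content_eq hq (mem_tableaux.1 hS)
  refine Finset.card_bij' (fun T _ => restrict hs.le T) (fun S hS => extend hs S n (hlt hS))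
    (fun T hT => ?_) (fun S hS => ?_) (fun T hT => ?_) fun S hS => restrict_extend hs S (hlt hS)
  · obtain ⟨hT', rfl⟩ := Finset.mem_filter.1 hT
    have hle := entry_le_of_content_eq_add_single hq (mem_tableaux.1 hT')
    refine mem_tableaux.2 (add_right_cancel (b := Finsupp.single n k) ?_)
    rw [← mem_tableaux.1 hT', ← content_extend hs _ (restrict_lowerShape_lt hs.le) hk,
      extend_restrict hle hs]
  · rw [Finset.mem_filter, mem_tableaux, content_extend _ _ _ hk, mem_tableaux.1 hS]
    exact ⟨rfl, lowerShape_extend hs S (hlt hS)⟩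
  · obtain ⟨hT', rfl⟩ := Finset.mem_filter.1 hT
    exact extend_restrict (entry_le_of_content_eq_add_single hq (mem_tableaux.1 hT')) hs

theorem coeff_schur_add_single (K : Type*) [CommRing K] (lam : YoungDiagram)
    (hq : ∀ i ∈ q.support, i < n) (k : ℕ) : (schur K lam).coeff (q + Finsupp.single n k) =
      ∑ mu ∈ below lam k, (schur K mu).coeff q := by
  simp only [coeff_schur, card_tableaux_add_single hq, Nat.cast_sum]

end Branching

/-! ### Complete homogeneous symmetric functions and the Pieri rule -/

theorem coeff_add_single_mul {σ R : Type*} [DecidableEq σ] [Semiring R] (F G : MvPowerSeries σ R)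
    {e : σ →₀ ℕ} {n : σ} (he : e n = 0) (b : ℕ) : (F * G).coeff (e + Finsupp.single n b) =
      ∑ ij ∈ Finset.HasAntidiagonal.antidiagonal b, ∑ pq ∈ Finset.HasAntidiagonal.antidiagonal e,
        F.coeff (pq.1 + Finsupp.single n ij.1) * G.coeff (pq.2 + Finsupp.single n ij.2) := by
  rw [MvPowerSeries.coeff_mul, ← Finset.sum_product']
  refine Finset.sum_bij' (fun r _ => ((r.1 n, r.2 n), (r.1.erase n, r.2.erase n)))
    (fun s _ => (s.2.1 + Finsupp.single n s.1.1, s.2.2 + Finsupp.single n s.1.2)) ?_ ?_ ?_ ?_ ?_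
  · rintro ⟨p, q⟩ h
    rw [Finset.HasAntidiagonal.mem_antidiagonal] at h
    simp only [Finset.mem_product, Finset.HasAntidiagonal.mem_antidiagonal]
    constructor
    · simpa [he] using DFunLike.congr_fun h n
    · rw [← Finsupp.erase_add, h, Finsupp.erase_add, Finsupp.erase_single, add_zero,
        Finsupp.erase_of_notMem_support (by simpa using he)]
  · rintro ⟨⟨i, j⟩, p, q⟩ h
    simp only [Finset.mem_product, Finset.HasAntidiagonal.mem_antidiagonal] at h ⊢
    rw [← h.1, ← h.2, Finsupp.single_add]
    abel
  · rintro ⟨p, q⟩ _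
    simp only [Finsupp.erase_add_single]
  · rintro ⟨⟨i, j⟩, p, q⟩ h
    simp only [Finset.mem_product, Finset.HasAntidiagonal.mem_antidiagonal] at h
    obtain ⟨hp, hq⟩ : p n = 0 ∧ q n = 0 := by rw [← add_eq_zero, ← Finsupp.add_apply, h.2, he]
    simp [hp, hq, Finsupp.erase_add, Finsupp.erase_of_notMem_support]
  · rintro ⟨p, q⟩ _
    simp only [Finsupp.erase_add_single]

theorem card_eq_zero_iff {lam : YoungDiagram} : lam.card = 0 ↔ lam = ⊥ := by
  rw [YoungDiagram.card, Finset.card_eq_zero, YoungDiagram.ext_iff, YoungDiagram.cells_bot]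

theorem above_zero (lam : YoungDiagram) : above lam 0 = {lam} := by
  ext mu
  rw [mem_above, Finset.mem_singleton, add_zero]
  constructor
  · rintro ⟨hcard, h⟩
    exact YoungDiagram.ext (Finset.eq_of_subset_of_card_le h.le hcard.le).symm
  · rintro rfl
    exact ⟨rfl, fun i => ⟨mu.rowLen_anti _ _ (Nat.le_succ i), le_rfl⟩⟩

section Complete

variable {K : Type*} [CommRing K]

variable (K) in
/-- The complete homogeneous symmetric function `h_n`, the sum of all monomials of degree `n`. -/
def hsymm (n : ℕ) : SymFun K :=
  ⟨fun d => if d.degree = n then 1 else 0, by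
    refine ⟨fun σ => MvPowerSeries.ext fun d => ?_, n, fun d hd => if_neg hd.ne'⟩
    obtain ⟨d, rfl⟩ := (Finsupp.mapDomain_surjective σ.surjective) d
    refine (coeff_rename_equiv σ _ d).trans ?_
    change (if _ then (1 : K) else 0) = if _ then 1 else 0
    rw [Finsupp.degree_mapDomain]⟩

theorem coeff_hsymm (n : ℕ) (d : ℕ →₀ ℕ) :
    (hsymm K n : MvPowerSeries ℕ K).coeff d = if d.degree = n then 1 else 0 := rfl

theorem hsymm_zero : hsymm K 0 = 1 := by
  classical
  refine Subtype.ext (MvPowerSeries.ext fun d => ?_)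
  rw [coeff_hsymm, OneMemClass.coe_one, MvPowerSeries.coeff_one]
  simp [Finsupp.degree_eq_zero_iff]

theorem coeff_hsymm_add_single (a i : ℕ) (p : ℕ →₀ ℕ) (n : ℕ) :
    (hsymm K a : MvPowerSeries ℕ K).coeff (p + Finsupp.single n i) =
      if i ≤ a then (hsymm K (a - i) : MvPowerSeries ℕ K).coeff p else 0 := by
  rw [coeff_hsymm, coeff_hsymm, map_add, Finsupp.degree_single, ← ite_and]
  exact if_congr (by omega) rfl rfl

theorem schur_bot : schur K ⊥ = 1 := by
  classical
  ext d
  rw [MvPowerSeries.coeff_one]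
  split_ifs with h
  · have hexpo : expo ⊥ = 0 := by
      rw [← Finsupp.degree_eq_zero_iff, degree_expo, card_eq_zero_iff]
    rw [h, ← hexpo]
    exact kostka_diag K (⟨⊥, rfl⟩ : Part _)
  · refine coeff_schur_of_degree_ne K ?_
    rwa [card_eq_zero_iff.2 rfl, Ne, Finsupp.degree_eq_zero_iff]

theorem coeff_zero_hsymm_mul_schur (lam : YoungDiagram) (a : ℕ) :
    ((hsymm K a : MvPowerSeries ℕ K) * schur K lam).coeff 0 =
      ∑ nu ∈ above lam a, (schur K nu).coeff 0 := by
  rcases eq_or_ne a 0 with rfl | ha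
  · rw [above_zero, Finset.sum_singleton, hsymm_zero, OneMemClass.coe_one, one_mul]
  · have hnu {nu} (h : nu ∈ above lam a) : (schur K nu).coeff 0 = 0 := by
      refine coeff_schur_of_degree_ne K ?_
      rw [map_zero, (mem_above.1 h).1]
      omega
    rw [Finset.sum_eq_zero fun nu => hnu, MvPowerSeries.coeff_zero_eq_constantCoeff_apply,
      map_mul, ← MvPowerSeries.coeff_zero_eq_constantCoeff_apply, coeff_hsymm, map_zero,
      if_neg ha.symm, zero_mul]

theorem coeff_add_single_hsymm_mul_schur (lam : YoungDiagram) (a b : ℕ) {e : ℕ →₀ ℕ} {n : ℕ}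
    (he : ∀ i ∈ e.support, i < n) :
    ((hsymm K a : MvPowerSeries ℕ K) * schur K lam).coeff (e + Finsupp.single n b) =
      ∑ p ∈ Finset.HasAntidiagonal.antidiagonal b with p.1 ≤ a, ∑ kap ∈ below lam p.2,
        ((hsymm K (a - p.1) : MvPowerSeries ℕ K) * schur K kap).coeff e := by
  have hen : e n = 0 := Finsupp.notMem_support_iff.1 fun h => (he n h).false
  have hsupp {pq : (ℕ →₀ ℕ) × (ℕ →₀ ℕ)} (hpq : pq ∈ Finset.HasAntidiagonal.antidiagonal e) (i)
      (hi : i ∈ pq.2.support) : i < n := by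
    rw [Finset.HasAntidiagonal.mem_antidiagonal] at hpq
    exact he i (Finsupp.support_mono (hpq ▸ le_add_self) hi)
  rw [coeff_add_single_mul _ _ hen, Finset.sum_filter]
  refine Finset.sum_congr rfl fun p _ => ?_
  simp only [coeff_hsymm_add_single]
  split_ifs with hp
  · simp only [MvPowerSeries.coeff_mul]
    rw [Finset.sum_comm]
    exact Finset.sum_congr rfl fun pq hpq => by
      rw [coeff_schur_add_single K _ (hsupp hpq), Finset.mul_sum]
  · simp only [zero_mul, Finset.sum_const_zero]

theorem hsymm_mul_schur (lam : YoungDiagram) (a : ℕ) :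
    (hsymm K a : MvPowerSeries ℕ K) * schur K lam = ∑ nu ∈ above lam a, schur K nu := by
  ext e
  rw [map_sum]
  induction e using Finsupp.induction_on_max generalizing lam a with
  | zero => exact coeff_zero_hsymm_mul_schur lam a
  | single_add n b e hn _ ih =>
    rw [add_comm, coeff_add_single_hsymm_mul_schur _ _ _ hn]
    simp only [coeff_schur_add_single K _ hn, sum_above_below, ih]

variable (K) in
/-- The product of the complete homogeneous symmetric functions `h_{d i}`. -/
def hsymmProd {α : Type*} (d : α →₀ ℕ) : SymFun K :=
  d.prod fun _ n => hsymm K n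

section Index

variable {α β : Type*}

theorem hsymmProd_zero : hsymmProd K (0 : α →₀ ℕ) = 1 := Finsupp.prod_zero_index

theorem hsymmProd_mapDomain {f : α → β} (hf : Function.Injective f) (d : α →₀ ℕ) :
    hsymmProd K (d.mapDomain f) = hsymmProd K d :=
  Finsupp.prod_mapDomain_index_inj hf

theorem hsymmProd_sumElim (d : α →₀ ℕ) (e : β →₀ ℕ) :
    hsymmProd K (d.sumElim e) = hsymmProd K d * hsymmProd K e := by
  simp only [hsymmProd, Finsupp.prod_sumElim, Function.comp_def]

theorem hsymmProd_add_single {d : α →₀ ℕ} {i : α} (hi : d i = 0) (n : ℕ) :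
    hsymmProd K (d + Finsupp.single i n) = hsymm K n * hsymmProd K d := by
  have hdisj : Disjoint d.support (Finsupp.single i n).support :=
    Disjoint.mono_right Finsupp.support_single_subset (by simpa using hi)
  have hsingle : hsymmProd K (Finsupp.single i n) = hsymm K n :=
    Finsupp.prod_single_index hsymm_zero
  rw [mul_comm, ← hsingle]
  exact Finsupp.prod_add_index_of_disjoint hdisj _

end Index

theorem hsymmProd_eq_sum (d : ℕ →₀ ℕ) : (hsymmProd K d : MvPowerSeries ℕ K) =
    ∑ lam ∈ diagrams d.degree, (schur K lam).coeff d • schur K lam := by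
  induction d using Finsupp.induction_on_max with
  | zero =>
    have h0 : diagrams 0 = {⊥} := by
      ext lam
      rw [mem_diagrams, card_eq_zero_iff, Finset.mem_singleton]
    simp [hsymmProd_zero, h0, schur_bot]
  | single_add n b e hn _ ih =>
    have hen : e n = 0 := Finsupp.notMem_support_iff.1 fun h => (hn n h).false
    rw [add_comm, hsymmProd_add_single hen, MulMemClass.coe_mul, ih, Finset.mul_sum]
    simp only [mul_smul_comm, hsymm_mul_schur, Finset.smul_sum, coeff_schur_add_single K _ hn,
      Finset.sum_smul]
    refine Finset.sum_comm' fun lam mu => ?_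
    rw [mem_below_iff_mem_above, mem_diagrams, mem_diagrams, map_add, Finsupp.degree_single,
      mem_above]
    constructor
    · rintro ⟨hlam, hmu, hs⟩
      exact ⟨⟨hmu, hs⟩, by omega⟩
    · rintro ⟨⟨hmu, hs⟩, h⟩
      exact ⟨by omega, hmu, hs⟩

theorem schurCoeff_hsymmProd (d : ℕ →₀ ℕ) (n : ℕ) (lam : Part n) :
    schurCoeff K n (hsymmProd K d : MvPowerSeries ℕ K) lam = (schur K lam.1).coeff d := by
  classical
  rw [hsymmProd_eq_sum, map_sum, Finset.sum_apply]
  simp only [map_smul, Pi.smul_apply, schurCoeff_schur, smul_eq_mul, mul_ite, mul_one, mul_zero]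
  rw [Finset.sum_ite_eq']
  split_ifs with h
  · rfl
  · rw [coeff_schur_of_degree_ne]
    exact fun h' => h (mem_diagrams.2 h'.symm)

end Complete

/-! ### Sorting exponents -/

theorem exists_antitone_enumeration {α M : Type*} [LinearOrder M] [Zero M] (d : α →₀ M) :
    ∃ a : Fin d.support.card ↪ α, Antitone (d ∘ a) ∧ ∀ k, d k ≠ 0 → k ∈ Set.range a := by
  let c := d.support.equivFin.symm
  let τ := Tuple.sort fun i => OrderDual.toDual (d (c i))
  refine ⟨(τ.trans c).toEmbedding.trans (Function.Embedding.subtype _),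
    fun _ _ h => Tuple.monotone_sort (fun i => OrderDual.toDual (d (c i))) h, fun k hk => ?_⟩
  obtain ⟨i, hi⟩ := (τ.trans c).surjective ⟨k, Finsupp.mem_support_iff.2 hk⟩
  exact ⟨i, congrArg Subtype.val hi⟩

theorem exists_perm_apply_eq_val {n : ℕ} (a : Fin n ↪ ℕ) :
    ∃ σ : Equiv.Perm ℕ, ∀ i, σ (a i) = i := by
  have := Equiv.Perm.isMultiplyPretransitive ℕ n
  obtain ⟨σ, hσ⟩ := MulAction.exists_smul_eq (Equiv.Perm ℕ) a Fin.valEmbedding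
  exact ⟨σ, DFunLike.congr_fun hσ⟩

theorem exists_antitone_mapDomain_perm (d : ℕ →₀ ℕ) :
    ∃ σ : Equiv.Perm ℕ, Antitone (d.mapDomain σ : ℕ → ℕ) := by
  obtain ⟨a, ha, hsupp⟩ := exists_antitone_enumeration d
  obtain ⟨σ, hσ⟩ := exists_perm_apply_eq_val a
  have happly (i : Fin _) : d.mapDomain σ i = d (a i) := by
    rw [← hσ, Finsupp.mapDomain_apply σ.injective]
  refine ⟨σ, fun k l hkl => ?_⟩
  by_cases hl : d.mapDomain σ l = 0
  · exact hl ▸ Nat.zero_le _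
  · obtain ⟨j, rfl⟩ : ∃ j : Fin d.support.card, (j : ℕ) = l := by
      obtain ⟨x, rfl⟩ := σ.surjective l
      rw [Finsupp.mapDomain_apply σ.injective] at hl
      obtain ⟨j, rfl⟩ := hsupp x hl
      exact ⟨j, (hσ j).symm⟩
    have hk : k = (⟨k, hkl.trans_lt j.2⟩ : Fin d.support.card) := rfl
    rw [hk, happly, happly]
    exact ha hkl

theorem exists_mapDomain_perm_eq_expo (d : ℕ →₀ ℕ) :
    ∃ (σ : Equiv.Perm ℕ) (lam : YoungDiagram), d.mapDomain σ = expo lam := by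
  obtain ⟨σ, hσ⟩ := exists_antitone_mapDomain_perm d
  obtain ⟨N, hN⟩ := Infinite.exists_notMem_finset (d.mapDomain σ).support
  refine ⟨σ, ofRowLen _ hσ ⟨N, Finsupp.notMem_support_iff.1 hN⟩, ?_⟩
  exact Finsupp.ext fun i => (congrFun (rowLen_ofRowLen hσ _) i).symm

/-! ### Duality for the Hall inner product -/

section Duality

variable {K : Type*} [CommRing K]

theorem eq_of_coeff_expo {F G : MvPowerSeries ℕ K} (hF : F ∈ SymSeries K) (hG : G ∈ SymSeries K)
    (h : ∀ lam : YoungDiagram, F.coeff (expo lam) = G.coeff (expo lam)) : F = G := by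
  ext d
  obtain ⟨σ, lam, hd⟩ := exists_mapDomain_perm_eq_expo d
  rw [← coeff_perm hF σ, ← coeff_perm hG σ, hd, h]

theorem eq_of_schurCoeff {F G : MvPowerSeries ℕ K} (hF : F ∈ SymSeries K) (hG : G ∈ SymSeries K)
    (h : ∀ n, schurCoeff K n F = schurCoeff K n G) : F = G := by
  refine eq_of_coeff_expo hF hG fun lam => ?_
  have hFlam := schurCoeff_spec K F (⟨lam, rfl⟩ : Part lam.card)
  rw [h] at hFlam
  exact hFlam.trans (schurCoeff_spec K G (⟨lam, rfl⟩ : Part lam.card)).symm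

theorem hall_apply (F : SymSeries K) (f : SymFun K) :
    hall F f = ∑ᶠ n : ℕ, ∑ lam : Part n, schurCoeff K n F.1 lam * schurCoeff K n f.1 lam := rfl

theorem hall_hsymmProd (F : SymSeries K) (d : ℕ →₀ ℕ) : hall F (hsymmProd K d) = F.1.coeff d := by
  obtain ⟨σ, mu, hd⟩ := exists_mapDomain_perm_eq_expo d
  rw [← hsymmProd_mapDomain σ.injective, ← coeff_perm F.2 σ, hd, hall_apply]
  simp only [schurCoeff_hsymmProd]
  rw [finsum_eq_single _ mu.card]
  · exact (schurCoeff_spec K F.1 (⟨mu, rfl⟩ : Part mu.card)).symm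
  · intro n hn
    refine Finset.sum_eq_zero fun lam _ => ?_
    rw [coeff_schur_of_card_ne, mul_zero]
    rwa [lam.2]

theorem hall_one (F : SymSeries K) : hall F 1 = MvPowerSeries.constantCoeff F.1 := by
  rw [← hsymmProd_zero, hall_hsymmProd, MvPowerSeries.coeff_zero_eq_constantCoeff_apply]

theorem schurCoeff_eq_zero {F : MvPowerSeries ℕ K} {n : ℕ}
    (h : ∀ d : ℕ →₀ ℕ, d.degree = n → F.coeff d = 0) : schurCoeff K n F = 0 := by
  refine schurCoeff_unique K _ _ fun mu => ?_
  rw [h _ (by rw [degree_expo, mu.2])]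
  simp

theorem exists_mem_span_schurCoeff_eq (n : ℕ) (A : Part n → K) :
    ∃ g ∈ Submodule.span K (Set.range (hsymmProd K : (ℕ →₀ ℕ) → SymFun K)),
      schurCoeff K n g.1 = A ∧ ∀ m, m ≠ n → schurCoeff K m g.1 = 0 := by
  let c : Part n → K := Matrix.mulVec (kostka K n)⁻¹ A
  have hcoeff (m) : schurCoeff K m (∑ mu : Part n, c mu • hsymmProd K (expo mu.1) : SymFun K) =
      fun lam => ∑ mu : Part n, c mu * (schur K lam.1).coeff (expo mu.1) := by
    funext lam
    simp only [AddSubmonoidClass.coe_finsetSum, Subalgebra.coe_smul, map_sum, map_smul,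
      Finset.sum_apply, Pi.smul_apply, schurCoeff_hsymmProd, smul_eq_mul]
  refine ⟨∑ mu : Part n, c mu • hsymmProd K (expo mu.1), Submodule.sum_mem _ fun mu _ =>
    Submodule.smul_mem _ _ (Submodule.subset_span ⟨_, rfl⟩), ?_, fun m hm => ?_⟩
  · have hc : Matrix.mulVec (kostka K n) c = A := by
      rw [Matrix.mulVec_mulVec, Matrix.mul_nonsing_inv _ (by rw [kostka_det]; exact isUnit_one),
        Matrix.one_mulVec]
    rw [hcoeff, ← hc]
    exact funext fun lam => Finset.sum_congr rfl fun mu _ => mul_comm _ _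
  · rw [hcoeff]
    refine funext fun lam => Finset.sum_eq_zero fun mu _ => ?_
    rw [coeff_schur_of_card_ne K _ _ (by rwa [lam.2, mu.2]), mul_zero]

theorem span_hsymmProd :
    Submodule.span K (Set.range (hsymmProd K : (ℕ →₀ ℕ) → SymFun K)) = ⊤ := by
  refine eq_top_iff.2 ?_
  rintro f -
  obtain ⟨hf, N, hN⟩ := f.2
  choose g hg hgn hgm using fun n => exists_mem_span_schurCoeff_eq n (schurCoeff K n f.1)
  have hsum : f = ∑ n ∈ Finset.range (N + 1), g n := by
    refine Subtype.ext (eq_of_schurCoeff hf (SetLike.coe_mem (p := SymFun K) _).1 fun n => ?_)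
    rw [AddSubmonoidClass.coe_finsetSum, map_sum, Finset.sum_eq_single n]
    · exact (hgn n).symm
    · exact fun m _ hm => hgm m n hm.symm
    · intro hn
      rw [hgn]
      refine schurCoeff_eq_zero fun d hd => hN d ?_
      rw [Finset.mem_range] at hn
      omega
  exact hsum ▸ Submodule.sum_mem _ fun n _ => hg n

end Duality

/-! ### Group-like series -/

section GroupLike

variable {K : Type*} [CommRing K]

theorem coeff_inXY (F : MvPowerSeries ℕ K) (u : ℕ ⊕ ℕ →₀ ℕ) :
    (inXY F).coeff u = F.coeff (u.mapDomain Equiv.natSumNatEquivNat) := by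
  obtain ⟨d, rfl⟩ := Finsupp.mapDomain_surjective Equiv.natSumNatEquivNat.symm.surjective u
  rw [← Finsupp.mapDomain_comp, Equiv.self_comp_symm, Finsupp.mapDomain_id]
  exact coeff_rename_equiv _ _ _

theorem hall_hsymmProd_mul (F : SymSeries K) (d e : ℕ →₀ ℕ) :
    hall F (hsymmProd K d * hsymmProd K e) = (inXY F.1).coeff (d.sumElim e) := by
  rw [← hsymmProd_sumElim, ← hsymmProd_mapDomain Equiv.natSumNatEquivNat.injective, hall_hsymmProd,
    coeff_inXY]

theorem inXY_eq_inX_mul_inY_iff (F : SymSeries K) : inXY F.1 = inX F.1 * inY F.1 ↔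
    ∀ f g, hall F (f * g) = hall F f * hall F g := by
  constructor
  · intro h
    have hbilin : (LinearMap.mul K (SymFun K)).compr₂ (hall F) =
        (LinearMap.mul K K).compl₁₂ (hall F) (hall F) :=
      LinearMap.ext_on_range span_hsymmProd fun d =>
        LinearMap.ext_on_range span_hsymmProd fun e => by
          rw [LinearMap.compr₂_apply, LinearMap.compl₁₂_apply, LinearMap.mul_apply',
            LinearMap.mul_apply', hall_hsymmProd_mul, h, coeff_inX_mul_inY, hall_hsymmProd,
            hall_hsymmProd]
    exact fun f g => LinearMap.congr_fun₂ hbilin f g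
  · intro h
    ext u
    rw [← Finsupp.comapDomain_sumElim_comapDomain u, coeff_inX_mul_inY, ← hall_hsymmProd_mul, h,
      hall_hsymmProd, hall_hsymmProd]

theorem isGroupLike_iff_exists_algHom (F : SymSeries K) :
    IsGroupLike F ↔ ∃ φ : SymFun K →ₐ[K] K, φ.toLinearMap = hall F := by
  rw [IsGroupLike, inXY_eq_inX_mul_inY_iff, ← hall_one]
  constructor
  · rintro ⟨hmul, hone⟩
    exact ⟨AlgHom.ofLinearMap (hall F) hone hmul, rfl⟩
  · rintro ⟨φ, hφ⟩
    rw [← hφ]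
    exact ⟨map_mul φ, map_one φ⟩

end GroupLike

/-! ### The operator `F^⊥` -/

theorem apply_lid_rTensor {R M N : Type*} [CommSemiring R] [AddCommMonoid M] [Module R M]
    [AddCommMonoid N] [Module R N] (a : M →ₗ[R] R) (b : N →ₗ[R] R) (t : M ⊗[R] N) :
    b (TensorProduct.lid R N (a.rTensor N t)) = a (TensorProduct.rid R M (b.lTensor M t)) := by
  induction t with
  | zero => simp only [map_zero]
  | add s t hs ht => simp only [map_add, hs, ht]
  | tmul m n => simp [mul_comm]

theorem bijective_of_map_sub_self_mem {A : Type*} [AddCommGroup A] (u : A →+ A)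
    (S : ℕ → AddSubgroup A) (h0 : S 0 = ⊥) (hS : ∀ x, ∃ n, x ∈ S n)
    (hu : ∀ n, ∀ x ∈ S (n + 1), u x - x ∈ S n) : Function.Bijective u := by
  constructor
  · refine (injective_iff_map_eq_zero u).2 fun x hx => ?_
    obtain ⟨n, hn⟩ := hS x
    induction n with
    | zero => rwa [h0, AddSubgroup.mem_bot] at hn
    | succ n ih => exact ih (by simpa [hx] using hu n x hn)
  · intro x
    obtain ⟨n, hn⟩ := hS x
    induction n generalizing x with
    | zero =>
      rw [h0, AddSubgroup.mem_bot] at hn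
      exact ⟨0, by rw [hn, map_zero]⟩
    | succ n ih =>
      obtain ⟨y, hy⟩ := ih _ (hu n x hn)
      exact ⟨x - y, by rw [map_sub, hy, sub_sub_cancel]⟩

section Perp

variable {K : Type*} [CommRing K]

variable (K) in
/-- The linear functional `f ↦ [x^e] f` on symmetric functions. -/
def lcoeff (e : ℕ →₀ ℕ) : SymFun K →ₗ[K] K :=
  MvPowerSeries.coeff e ∘ₗ (SymFun K).val.toLinearMap

theorem lcoeff_apply (e : ℕ →₀ ℕ) (f : SymFun K) : lcoeff K e f = f.1.coeff e := rfl

/-- The coefficient of `y^e` in `f(x, y)`, a symmetric function of `x`. -/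
def coeffY (f : SymFun K) (e : ℕ →₀ ℕ) : SymFun K :=
  TensorProduct.rid K (SymFun K) ((lcoeff K e).lTensor (SymFun K) (coproduct K f))

theorem coeff_coeffY (f : SymFun K) (e d : ℕ →₀ ℕ) :
    (coeffY f e : MvPowerSeries ℕ K).coeff d = (inXY f.1).coeff (d.sumElim e) := by
  rw [← tensorToXY_coproduct, coeffY]
  induction coproduct K f with
  | zero => simp only [map_zero, ZeroMemClass.coe_zero]
  | add s t hs ht => simp only [map_add, AddMemClass.coe_add, hs, ht]
  | tmul g h =>
    rw [tensorToXY_tmul, coeff_inX_mul_inY, LinearMap.lTensor_tmul, TensorProduct.rid_tmul,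
      Subalgebra.coe_smul, map_smul, smul_eq_mul, mul_comm, lcoeff_apply]

theorem coeff_perp (F : SymSeries K) (f : SymFun K) (e : ℕ →₀ ℕ) :
    (perp F f : MvPowerSeries ℕ K).coeff e = hall F (coeffY f e) :=
  apply_lid_rTensor (hall F) (lcoeff K e) (coproduct K f)

theorem coeff_inXY_sumElim_zero (F : SymSeries K) (d : ℕ →₀ ℕ) :
    (inXY F.1).coeff (d.sumElim 0) = F.1.coeff d := by
  rw [← hall_hsymmProd_mul, hsymmProd_zero, mul_one, hall_hsymmProd]

theorem coeff_inXY_zero_sumElim (F : SymSeries K) (e : ℕ →₀ ℕ) :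
    (inXY F.1).coeff (Finsupp.sumElim 0 e) = F.1.coeff e := by
  rw [← hall_hsymmProd_mul, hsymmProd_zero, one_mul, hall_hsymmProd]

theorem coeffY_zero (f : SymFun K) : coeffY f 0 = f := by
  refine Subtype.ext (MvPowerSeries.ext fun d => ?_)
  rw [coeff_coeffY]
  exact coeff_inXY_sumElim_zero ⟨f.1, f.2.1⟩ d

theorem coeff_zero_coeffY (f : SymFun K) (e : ℕ →₀ ℕ) :
    (coeffY f e : MvPowerSeries ℕ K).coeff 0 = f.1.coeff e := by
  rw [coeff_coeffY]
  exact coeff_inXY_zero_sumElim ⟨f.1, f.2.1⟩ e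

theorem constantCoeff_perp (F : SymSeries K) (f : SymFun K) :
    MvPowerSeries.constantCoeff (perp F f : MvPowerSeries ℕ K) = hall F f := by
  rw [← MvPowerSeries.coeff_zero_eq_constantCoeff_apply, coeff_perp, coeffY_zero]

variable (K) in
/-- The submodule of the symmetric functions of degree less than `n`. -/
def degreeLT (n : ℕ) : Submodule K (SymFun K) :=
  ⨅ d : {d : ℕ →₀ ℕ // n ≤ d.degree}, LinearMap.ker (lcoeff K d.1)

theorem mem_degreeLT {n : ℕ} {f : SymFun K} :
    f ∈ degreeLT K n ↔ ∀ d : ℕ →₀ ℕ, n ≤ d.degree → f.1.coeff d = 0 := by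
  simp [degreeLT, lcoeff_apply]

theorem degreeLT_zero : degreeLT K 0 = ⊥ := by
  refine eq_bot_iff.2 fun f hf => ?_
  exact Subtype.ext (MvPowerSeries.ext fun d => mem_degreeLT.1 hf d (Nat.zero_le _))

theorem exists_mem_degreeLT (f : SymFun K) : ∃ n, f ∈ degreeLT K n :=
  f.2.2.imp' Nat.succ fun _ => mem_degreeLT.2

theorem coeffY_eq_smul_one {n : ℕ} {f : SymFun K} (hf : f ∈ degreeLT K (n + 1)) {e : ℕ →₀ ℕ}
    (he : n ≤ e.degree) : coeffY f e = f.1.coeff e • (1 : SymFun K) := by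
  classical
  refine Subtype.ext (MvPowerSeries.ext fun d => ?_)
  rw [Subalgebra.coe_smul, map_smul, OneMemClass.coe_one, MvPowerSeries.coeff_one, smul_eq_mul]
  split_ifs with hd
  · rw [hd, coeff_zero_coeffY, mul_one]
  · rw [coeff_coeffY, coeff_inXY, mul_zero]
    refine mem_degreeLT.1 hf _ ?_
    rw [Finsupp.degree_mapDomain, Finsupp.sumElim_eq_add, map_add, Finsupp.degree_mapDomain,
      Finsupp.degree_mapDomain]
    have : d.degree ≠ 0 := (Finsupp.degree_eq_zero_iff d).not.2 hd
    omega

theorem perp_sub_self_mem {F : SymSeries K} (hF : MvPowerSeries.constantCoeff F.1 = 1) {n : ℕ}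
    {f : SymFun K} (hf : f ∈ degreeLT K (n + 1)) : perp F f - f ∈ degreeLT K n := by
  refine mem_degreeLT.2 fun e he => ?_
  rw [AddSubgroupClass.coe_sub, map_sub, coeff_perp, coeffY_eq_smul_one hf he, map_smul, hall_one,
    hF, smul_eq_mul, mul_one, sub_self]

theorem perp_bijective {F : SymSeries K} (hF : MvPowerSeries.constantCoeff F.1 = 1) :
    Function.Bijective (perp F) :=
  bijective_of_map_sub_self_mem (perp F).toAddMonoidHom (fun n => (degreeLT K n).toAddSubgroup)
    (by rw [degreeLT_zero, Submodule.bot_toAddSubgroup]) exists_mem_degreeLT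
    fun _ _ => perp_sub_self_mem hF

/-- `F^⊥` as an algebra endomorphism, when `φ = (F, -)` is an algebra homomorphism. -/
def perpAlgHom (φ : SymFun K →ₐ[K] K) : SymFun K →ₐ[K] SymFun K :=
  ((Algebra.TensorProduct.lid K (SymFun K)).toAlgHom.comp
    (Algebra.TensorProduct.map φ (AlgHom.id K (SymFun K)))).comp (coproduct K)

theorem toLinearMap_perpAlgHom {F : SymSeries K} {φ : SymFun K →ₐ[K] K}
    (hφ : φ.toLinearMap = hall F) : (perpAlgHom φ).toLinearMap = perp F := by
  rw [perp, ← hφ]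
  rfl

theorem exists_algEquiv_perp {F : SymSeries K} {φ : SymFun K →ₐ[K] K}
    (hφ : φ.toLinearMap = hall F) :
    ∃ ψ : SymFun K ≃ₐ[K] SymFun K, ψ.toLinearMap = perp F := by
  have hF : MvPowerSeries.constantCoeff F.1 = 1 := by
    rw [← hall_one, ← hφ]
    exact map_one φ
  have hbij : Function.Bijective (perpAlgHom φ) := by
    have h := perp_bijective hF
    rwa [← toLinearMap_perpAlgHom hφ] at h
  exact ⟨AlgEquiv.ofBijective _ hbij, toLinearMap_perpAlgHom hφ⟩

theorem exists_algHom_hall {F : SymSeries K} {ψ : SymFun K →ₐ[K] SymFun K}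
    (hψ : ψ.toLinearMap = perp F) : ∃ φ : SymFun K →ₐ[K] K, φ.toLinearMap = hall F := by
  have hall_eq (f) : hall F f = MvPowerSeries.constantCoeff (ψ f).1 := by
    rw [← constantCoeff_perp, ← hψ, AlgHom.toLinearMap_apply]
  refine ⟨AlgHom.ofLinearMap (hall F) ?_ fun f g => ?_, rfl⟩
  · rw [hall_eq, map_one, OneMemClass.coe_one, map_one]
  · rw [hall_eq, hall_eq, hall_eq, map_mul, MulMemClass.coe_mul, map_mul]

end Perp

end SymmFn

end

theorem mainTheorem7 {K : Type*} [CommRing K] (F : SymmFn.SymSeries K) :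
    [SymmFn.IsGroupLike F,
      ∃ φ : SymmFn.SymFun K →ₐ[K] K, φ.toLinearMap = SymmFn.hall F,
      ∃ φ : SymmFn.SymFun K ≃ₐ[K] SymmFn.SymFun K, φ.toLinearMap = SymmFn.perp F].TFAE := by
  tfae_have 1 ↔ 2 := SymmFn.isGroupLike_iff_exists_algHom F
  tfae_have 2 → 3 := fun ⟨_, hφ⟩ => SymmFn.exists_algEquiv_perp hφ
  tfae_have 3 → 2 := fun ⟨ψ, hψ⟩ => SymmFn.exists_algHom_hall (ψ := ψ.toAlgHom) hψ
  tfae_finish
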